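/- Let $K\in\mathbb R^{n\times n}$ ($n\ge 2$) be symmetric positive semidefinite (the Gram matrix of a kernel at $n$ data points), with columns $K_1,\dots,K_n$, diagonal entries $\lambda_i=K_{i,i}$ ordered as $\lambda_1\ge\dots\ge\lambda_n$, off-diagonal entries $|K_{i,j}|\le\tau$ for $i\ne j$, and largest eigenvalue $\gamma_1$. Let $y\in\mathbb R^n$ and $\hat\alpha=K^{-1}y$. From $\alpha_0\in\mathbb R^n$ run stochastic gradient descent on $\frac1{2n}\|y-K\alpha\|_2^2$, that is $\alpha_{t+1}=\alpha_t-\eta_t(K_{i_t}^T\alpha_t-y_{i_t})K_{i_t}$ with $i_0,i_1,\dots$ independent and uniform on $\{1,\dots,n\}$, with step size $\eta_1$ in steps $1,\dots,k_1$ and step size $\eta_2>0$ in steps $k_1+1,\dots,k_2$, where, for positive constants $C_1,C_2,C_3$, $$\frac{2}{\lambda_1^2-C_1\sqrt n\,\tau}<\eta_1<\frac{2}{\lambda_2^2+C_2\sqrt n\,\tau},\qquad \eta_2<\frac{1}{\lambda_1^2+C_3\sqrt n\,\tau}.$$ Put $b_t=\alpha_t-\hat\alpha$, and let $P_1$ be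 the orthogonal projection onto the orthogonal complement of $\mathrm{span}(K_2,\dots,K_n)$. Assume, with positive constants $c_1,c_2,\delta,\beta_0,M$, that $c_1\le\lambda_n$, $\lambda_1\le c_2$, $\lambda_2^2+\delta\le\lambda_1^2$, $\|b_0\|_2\le M$ and $\|P_1b_0\|_2\ge\beta_0$. Then there are $p>0$, $C>0$ and an integer $m\ge1$, depending only on $c_1,c_2,\delta,\beta_0,M,C_1,C_2,C_3$ (for all $n$, $K$, $\tau$, $y$, $\alpha_0$, $\eta_1$, $\eta_2$ as above), such that for every $0<\varepsilon<1$ with $n\tau<p\,\varepsilon^m$ there exist integers $0\le k_1<k_2$ with $k_1\le C\,n\log\frac1\varepsilon$, $E\|b_{k_2}\|_2>0$ and $$(1-2\varepsilon)\,\gamma_1\ \le\ \frac{E\|Kb_{k_2}\|_2}{E\|b_{k_2}\|_2}\ \le\ \gamma_1 .$$ -/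

import Mathlib

open MeasureTheory ProbabilityTheory Matrix

noncomputable section

namespace KernelSGD

variable {n : ℕ}

/-- The `i`-th column (equivalently, for a symmetric matrix, the `i`-th row) of `K`, as a vector of
Euclidean space. -/
def col (K : Matrix (Fin n) (Fin n) ℝ) (i : Fin n) : EuclideanSpace ℝ (Fin n) :=
  WithLp.toLp 2 (fun j => K j i)

/-- The product `K v` in Euclidean space. -/
def app (K : Matrix (Fin n) (Fin n) ℝ) (v : EuclideanSpace ℝ (Fin n)) :
    EuclideanSpace ℝ (Fin n) :=
  WithLp.toLp 2 (K *ᵥ v.ofLp)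

/-- The iterates of stochastic gradient descent for `(1/2n) ‖y - K α‖²`, started at `α₀`, with step
size `η t` and sampled index `i t` in the step from the `t`-th to the `(t+1)`-st iterate:
`α_{t+1} = α_t - η_t (K_{i_t}ᵀ α_t - y_{i_t}) K_{i_t}`. -/
def sgd (K : Matrix (Fin n) (Fin n) ℝ) (y : EuclideanSpace ℝ (Fin n)) (η : ℕ → ℝ)
    (α₀ : EuclideanSpace ℝ (Fin n)) (i : ℕ → Fin n) : ℕ → EuclideanSpace ℝ (Fin n)
  | 0 => α₀
  | t + 1 => sgd K y η α₀ i t -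
      (η t * (inner ℝ (col K (i t)) (sgd K y η α₀ i t) - y (i t))) • col K (i t)

/-- The two-stage step-size schedule: `η₁` for the first `k₁` steps, `η₂` afterwards. -/
def twoStage (η₁ η₂ : ℝ) (k₁ : ℕ) (t : ℕ) : ℝ := if t < k₁ then η₁ else η₂

/-- The minimizer `α̂ = K⁻¹ y` of the least-squares objective (`K` invertible). -/
def alphaHat (K : Matrix (Fin n) (Fin n) ℝ) (y : EuclideanSpace ℝ (Fin n)) :
    EuclideanSpace ℝ (Fin n) :=
  app K⁻¹ y

/-- The error `b_t = α_t - α̂` of the two-stage SGD after `t` steps. -/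
def err (K : Matrix (Fin n) (Fin n) ℝ) (y α₀ : EuclideanSpace ℝ (Fin n)) (η₁ η₂ : ℝ) (k₁ : ℕ)
    (i : ℕ → Fin n) (t : ℕ) : EuclideanSpace ℝ (Fin n) :=
  sgd K y (twoStage η₁ η₂ k₁) α₀ i t - alphaHat K y

/-- The map `P₁ = I - P₋₁`, where `P₋₁` is the orthogonal projection onto the span of all columns of
`K` but the first. -/
def projOne [NeZero n] (K : Matrix (Fin n) (Fin n) ℝ) (v : EuclideanSpace ℝ (Fin n)) :
    EuclideanSpace ℝ (Fin n) :=
  v - (Submodule.span ℝ (col K '' {j | j ≠ 0})).starProjection v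

/-- `i 0, i 1, …` are independent and uniformly distributed on the `n` indices. -/
structure IsUniformSampling {Ω : Type*} [MeasurableSpace Ω] (μ : Measure Ω)
    (i : ℕ → Ω → Fin n) : Prop where
  measurable : ∀ t, Measurable (i t)
  indep : iIndepFun i μ
  uniform : ∀ t j, μ {ω | i t ω = j} = (n : ENNReal)⁻¹

end KernelSGD

end

/-! The error evolves by `b ↦ b - η ⟪k, b⟫ k`, with `k` the sampled column (`err_succ`). Let `u` be
the normalised vector `K⁻¹ e₀`, so that `K u = a e₀`. It is orthogonal to all columns but the first
and spans the line onto which P₁ projects. By diagonal dominance it is close to `e₀`, so `a`, λ₁ and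
γ₁ agree up to O(nτ).

Split `b` into `⟪u, b⟫ u` and the rest, `perp u b`, and follow the means S = E|⟪u, b⟫| and Z =
E‖perp u b‖. Only the first column changes `⟪u, b⟫`, by the factor `1 - η a²` up to a leak from
`perp u b`; the other columns act on `perp u b` alone and shrink it on average. All couplings are at
most a constant times nτ (`expected_step_of_coupling_le`). The step size η₁ overshoots along `u` but
not along the other columns. Since λ₁² - λ₂² ≥ δ, either S grows or Z shrinks at a definite rate
(`stage_one_gap`), so Z/S contracts by `1 - g/n` per step down to a floor of order nτ (`ratio_step`,
`ratio_two_stage`).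

After order n log(1/ε) steps the ratio is a small multiple of ε. One step with η₂ costs only a
constant factor, so k₂ = k₁ + 1 suffices. Then `b` is nearly parallel to `u` in mean, and `K`
stretches it by about `a` (`quotient_bounds`). -/

namespace KernelSGD

/-! ### Relaxed projections relative to a unit direction -/

section Geometry

variable {F ι : Type*} [NormedAddCommGroup F] [InnerProductSpace ℝ F]

/-- One relaxed projection step along `k`. -/
def relax (η : ℝ) (k b : F) : F := b - (η * inner ℝ k b) • k

/-- The component of `b` orthogonal to the unit vector `u`. -/
def perp (u b : F) : F := b - (inner ℝ u b : ℝ) • u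

theorem norm_relax_sq (η : ℝ) (k z : F) :
    ‖relax η k z‖ ^ 2 = ‖z‖ ^ 2 - η * (2 - η * ‖k‖ ^ 2) * (inner ℝ k z) ^ 2 := by
  rw [relax, norm_sub_sq_real, norm_smul, inner_smul_right, real_inner_comm k z, mul_pow,
    Real.norm_eq_abs, sq_abs]
  ring

/-- By AM-GM, `‖x‖ ‖z‖ ≤ (‖x‖² + ‖z‖²) / 2`. The exact identity for squares thus yields a decrease
of the norm itself, without square roots, and it can be summed over columns. -/
theorem norm_relax_mul_norm_le {η L : ℝ} {k : F} (hη : 0 ≤ η) (hk : ‖k‖ ^ 2 ≤ L) (z : F) :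
    ‖relax η k z‖ * ‖z‖ ≤ ‖z‖ ^ 2 - η * (2 - η * L) / 2 * (inner ℝ k z) ^ 2 := by
  have h1 := norm_relax_sq η k z
  have h2 : η * (2 - η * L) * (inner ℝ k z) ^ 2 ≤ η * (2 - η * ‖k‖ ^ 2) * (inner ℝ k z) ^ 2 := by
    gcongr
  nlinarith [sq_nonneg (‖relax η k z‖ - ‖z‖)]

theorem sum_norm_relax_le {s : Finset ι} {k : ι → F} {η L σ : ℝ} {z : F} (hη : 0 ≤ η)
    (hk : ∀ j ∈ s, ‖k j‖ ^ 2 ≤ L) (hL : η * L ≤ 2)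
    (hσ : σ * ‖z‖ ^ 2 ≤ ∑ j ∈ s, (inner ℝ (k j) z) ^ 2) :
    ∑ j ∈ s, ‖relax η (k j) z‖ ≤ (s.card - η * (2 - η * L) / 2 * σ) * ‖z‖ := by
  rcases eq_or_ne z 0 with rfl | hz
  · simp [relax]
  have hz' : 0 < ‖z‖ := norm_pos_iff.2 hz
  refine le_of_mul_le_mul_right ?_ hz'
  have h1 : (∑ j ∈ s, ‖relax η (k j) z‖) * ‖z‖
      ≤ ∑ j ∈ s, (‖z‖ ^ 2 - η * (2 - η * L) / 2 * (inner ℝ (k j) z) ^ 2) := by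
    rw [Finset.sum_mul]
    exact Finset.sum_le_sum fun j hj => norm_relax_mul_norm_le hη (hk j hj) z
  rw [Finset.sum_sub_distrib, Finset.sum_const, nsmul_eq_mul, ← Finset.mul_sum] at h1
  have h2 : 0 ≤ η * (2 - η * L) / 2 := by
    have : 0 ≤ 2 - η * L := by linarith
    positivity
  have h3 := mul_le_mul_of_nonneg_left hσ h2
  nlinarith

theorem perp_add_smul (u b : F) : perp u b + (inner ℝ u b : ℝ) • u = b := by
  simp [perp]

theorem inner_perp {u : F} (hu : ‖u‖ = 1) (b : F) : inner ℝ u (perp u b) = (0 : ℝ) := by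
  rw [perp, inner_sub_right, inner_smul_right, real_inner_self_eq_norm_sq, hu]
  ring

theorem norm_perp_sq {u : F} (hu : ‖u‖ = 1) (b : F) :
    ‖perp u b‖ ^ 2 = ‖b‖ ^ 2 - (inner ℝ u b) ^ 2 := by
  rw [perp, norm_sub_sq_real, norm_smul, inner_smul_right, real_inner_comm u b, mul_pow, hu,
    Real.norm_eq_abs, sq_abs]
  ring

theorem norm_perp_le {u : F} (hu : ‖u‖ = 1) (b : F) : ‖perp u b‖ ≤ ‖b‖ := by
  have h := norm_perp_sq hu b
  exact le_of_sq_le_sq (by nlinarith [sq_nonneg (inner ℝ u b : ℝ)]) (norm_nonneg _)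

theorem inner_eq_add_inner_perp {u : F} (k b : F) :
    inner ℝ k b = (inner ℝ u b : ℝ) * inner ℝ u k + inner ℝ k (perp u b) := by
  rw [perp, inner_sub_right, inner_smul_right, real_inner_comm u k]
  ring

theorem inner_perp_perp {u : F} (hu : ‖u‖ = 1) (k b : F) :
    inner ℝ (perp u k) (perp u b) = (inner ℝ k (perp u b) : ℝ) := by
  conv_lhs => rw [perp]
  rw [inner_sub_left, inner_smul_left, inner_perp hu]
  simp

theorem perp_relax (u : F) (η : ℝ) (k b : F) :
    perp u (relax η k b) = perp u b - (η * inner ℝ k b) • perp u k := by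
  simp only [perp, relax, inner_sub_right, inner_smul_right]
  module

theorem perp_relax_of_inner_eq_zero {u k : F} (hk : inner ℝ u k = (0 : ℝ)) (η : ℝ) (b : F) :
    perp u (relax η k b) = relax η k (perp u b) := by
  rw [perp_relax, relax, inner_eq_add_inner_perp (u := u) k b, hk]
  simp [perp, hk]

theorem inner_relax (u : F) (η : ℝ) (k b : F) :
    inner ℝ u (relax η k b) = inner ℝ u b - η * inner ℝ k b * (inner ℝ u k : ℝ) := by
  rw [relax, inner_sub_right, inner_smul_right]

theorem abs_inner_perp_le {u : F} (hu : ‖u‖ = 1) (k b : F) :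
    |(inner ℝ k (perp u b) : ℝ)| ≤ ‖perp u k‖ * ‖perp u b‖ := by
  rw [← inner_perp_perp hu]
  exact abs_real_inner_le_norm _ _

/-- Columns orthogonal to `u` leave `⟪u, b⟫` fixed. Column `i₀` multiplies it by `1 - η a²` and adds
a leak controlled by Cauchy-Schwarz on the parts orthogonal to `u`. -/
theorem le_sum_abs_inner_relax [Fintype ι] [DecidableEq ι] {k : ι → F} {u : F} (hu : ‖u‖ = 1)
    {i₀ : ι} (hk : ∀ j, j ≠ i₀ → inner ℝ u (k j) = (0 : ℝ)) {η : ℝ} (hη : 0 ≤ η)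
    (ha : 0 ≤ (inner ℝ u (k i₀) : ℝ)) (b : F) :
    (Fintype.card ι - 1 + |1 - η * (inner ℝ u (k i₀)) ^ 2|) * |(inner ℝ u b : ℝ)|
        - η * inner ℝ u (k i₀) * ‖perp u (k i₀)‖ * ‖perp u b‖
      ≤ ∑ j, |(inner ℝ u (relax η (k j) b) : ℝ)| := by
  rw [← Finset.add_sum_erase _ _ (Finset.mem_univ i₀)]
  have h1 : ∑ j ∈ Finset.univ.erase i₀, |(inner ℝ u (relax η (k j) b) : ℝ)|
      = (Fintype.card ι - 1) * |(inner ℝ u b : ℝ)| := by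
    rw [Finset.sum_congr rfl (g := fun _ => |(inner ℝ u b : ℝ)|)]
    · rw [Finset.sum_const, Finset.card_erase_of_mem (Finset.mem_univ _), nsmul_eq_mul,
        Nat.cast_sub (by exact Finset.card_pos.2 ⟨i₀, Finset.mem_univ _⟩)]
      simp
    · intro j hj
      rw [inner_relax, hk j (Finset.ne_of_mem_erase hj)]
      simp
  have h2 : |1 - η * (inner ℝ u (k i₀)) ^ 2| * |(inner ℝ u b : ℝ)|
        - η * inner ℝ u (k i₀) * ‖perp u (k i₀)‖ * ‖perp u b‖
      ≤ |(inner ℝ u (relax η (k i₀) b) : ℝ)| := by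
    set a : ℝ := inner ℝ u (k i₀)
    have e : (inner ℝ u (relax η (k i₀) b) : ℝ) = (1 - η * a ^ 2) * inner ℝ u b
        - η * a * inner ℝ (k i₀) (perp u b) := by
      rw [inner_relax, inner_eq_add_inner_perp (u := u) (k i₀) b]
      ring
    have h3 := abs_inner_perp_le hu (k i₀) b
    have h4 : |η * a * inner ℝ (k i₀) (perp u b)|
        ≤ η * a * (‖perp u (k i₀)‖ * ‖perp u b‖) := by
      rw [abs_mul, abs_of_nonneg (mul_nonneg hη ha)]
      exact mul_le_mul_of_nonneg_left h3 (mul_nonneg hη ha)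
    have h5 := abs_sub_abs_le_abs_sub ((1 - η * a ^ 2) * inner ℝ u b)
      (η * a * inner ℝ (k i₀) (perp u b))
    rw [e]
    rw [abs_mul (1 - η * a ^ 2)] at h5
    linarith
  rw [h1]
  linarith

/-- For columns orthogonal to `u`, relaxation commutes with `perp u`, so `sum_norm_relax_le`
applies. Column `i₀` may break the contraction and is bounded by the triangle inequality; its cost
is small because it is nearly parallel to `u`. -/
theorem sum_norm_perp_relax_le [Fintype ι] [DecidableEq ι] {k : ι → F} {u : F} (hu : ‖u‖ = 1)
    {i₀ : ι} (hk : ∀ j, j ≠ i₀ → inner ℝ u (k j) = (0 : ℝ)) {η L σ : ℝ} (hη : 0 ≤ η)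
    (ha : 0 ≤ (inner ℝ u (k i₀) : ℝ)) (hkL : ∀ j, j ≠ i₀ → ‖k j‖ ^ 2 ≤ L) (hL : η * L ≤ 2)
    (hσ : ∀ z, inner ℝ u z = (0 : ℝ) →
      σ * ‖z‖ ^ 2 ≤ ∑ j ∈ Finset.univ.erase i₀, (inner ℝ (k j) z) ^ 2) (b : F) :
    ∑ j, ‖perp u (relax η (k j) b)‖
      ≤ (Fintype.card ι - η * (2 - η * L) / 2 * σ + η * ‖perp u (k i₀)‖ ^ 2) * ‖perp u b‖
        + η * inner ℝ u (k i₀) * ‖perp u (k i₀)‖ * |(inner ℝ u b : ℝ)| := by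
  rw [← Finset.add_sum_erase _ _ (Finset.mem_univ i₀)]
  have h1 : ∑ j ∈ Finset.univ.erase i₀, ‖perp u (relax η (k j) b)‖
      ≤ (Fintype.card ι - 1 - η * (2 - η * L) / 2 * σ) * ‖perp u b‖ := by
    rw [Finset.sum_congr rfl (g := fun j => ‖relax η (k j) (perp u b)‖)]
    · have := sum_norm_relax_le (s := Finset.univ.erase i₀) hη
        (fun j hj => hkL j (Finset.ne_of_mem_erase hj)) hL (hσ (perp u b) (inner_perp hu b))
      rwa [Finset.card_erase_of_mem (Finset.mem_univ _),
        Nat.cast_sub (by exact Finset.card_pos.2 ⟨i₀, Finset.mem_univ _⟩), Finset.card_univ,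
        Nat.cast_one] at this
    · intro j hj
      rw [perp_relax_of_inner_eq_zero (hk j (Finset.ne_of_mem_erase hj))]
  have h2 : ‖perp u (relax η (k i₀) b)‖ ≤ (1 + η * ‖perp u (k i₀)‖ ^ 2) * ‖perp u b‖
        + η * inner ℝ u (k i₀) * ‖perp u (k i₀)‖ * |(inner ℝ u b : ℝ)| := by
    set a : ℝ := inner ℝ u (k i₀) with ha'
    have h3 := abs_inner_perp_le hu (k i₀) b
    have h4 : |(inner ℝ (k i₀) b : ℝ)|
        ≤ a * |(inner ℝ u b : ℝ)| + ‖perp u (k i₀)‖ * ‖perp u b‖ := by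
      rw [inner_eq_add_inner_perp (u := u) (k i₀) b, ← ha']
      refine (abs_add_le _ _).trans ?_
      rw [abs_mul, abs_of_nonneg ha]
      linarith
    rw [perp_relax]
    refine (norm_sub_le _ _).trans ?_
    rw [norm_smul, Real.norm_eq_abs, abs_mul, abs_of_nonneg hη]
    have h5 := mul_le_mul_of_nonneg_left h4 (mul_nonneg hη (norm_nonneg (perp u (k i₀))))
    nlinarith
  linarith

end Geometry

/-! ### Expectations along independent uniform indices -/

section Sampling

variable {Ω F : Type*} [MeasurableSpace Ω] {μ : Measure Ω} {n : ℕ}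
  {i : ℕ → Ω → Fin n}

/-- A process is adapted if its value at time `t` depends on the first `t` indices only. -/
def DependsOnPast (B : (ℕ → Fin n) → ℕ → F) : Prop :=
  ∀ (x x' : ℕ → Fin n) (t : ℕ), (∀ s < t, x s = x' s) → B x t = B x' t

theorem dependsOnPast_of_succ {B : (ℕ → Fin n) → ℕ → F} {b₀ : F} {Φ : ℕ → Fin n → F → F}
    (h0 : ∀ x, B x 0 = b₀) (hs : ∀ x t, B x (t + 1) = Φ t (x t) (B x t)) :
    DependsOnPast B := by
  intro x x' t
  induction t with
  | zero => intro _; rw [h0, h0]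
  | succ t ih =>
    intro h
    rw [hs, hs, h t (Nat.lt_succ_self t), ih fun s hs => h s (hs.trans (Nat.lt_succ_self t))]

/-- An adapted process is a function of the finite vector of past indices. -/
theorem DependsOnPast.exists_factor [NeZero n] {B : (ℕ → Fin n) → ℕ → F} (hB : DependsOnPast B)
    (t : ℕ) : ∃ β : (Finset.range t → Fin n) → F,
      ∀ x : ℕ → Fin n, B x t = β fun s => x s := by
  refine ⟨fun r => B (fun s => if h : s ∈ Finset.range t then r ⟨s, h⟩ else 0) t, fun x => ?_⟩
  apply hB
  intro s hs
  simp [hs]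

theorem IsUniformSampling.measurable_past (h : IsUniformSampling μ i) (t : ℕ) :
    Measurable fun ω (s : Finset.range t) => i s ω :=
  measurable_pi_lambda _ fun s => h.measurable s

/-- The past takes finitely many values, so `f` needs no regularity and `F` no structure. -/
theorem IsUniformSampling.integrable_comp [IsProbabilityMeasure μ] [NeZero n]
    (h : IsUniformSampling μ i) {B : (ℕ → Fin n) → ℕ → F} (hB : DependsOnPast B) (t : ℕ) (f : F → ℝ) :
    Integrable (fun ω => f (B (fun s => i s ω) t)) μ := by
  obtain ⟨β, hβ⟩ := hB.exists_factor t
  simp only [hβ]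
  have hm : Measurable fun r => f (β r) := measurable_of_countable _
  obtain ⟨C, hC⟩ := (Set.finite_range fun r => ‖f (β r)‖).bddAbove
  exact Integrable.of_bound (hm.comp (h.measurable_past t)).aestronglyMeasurable C
    (Filter.Eventually.of_forall fun ω => hC ⟨_, rfl⟩)

theorem IsUniformSampling.indepFun_past (h : IsUniformSampling μ i) (t : ℕ) :
    IndepFun (fun ω (s : Finset.range t) => i s ω) (i t) μ := by
  have h1 := h.indep.indepFun_finset (Finset.range t) {t} (by simp) h.measurable
  exact h1.comp (φ := id) (ψ := fun r : ({t} : Finset ℕ) → Fin n => r ⟨t, by simp⟩)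
    measurable_id (measurable_pi_apply _)

/-- The index drawn at time `t` is uniform and independent of the past. -/
theorem IsUniformSampling.integral_step [IsProbabilityMeasure μ] [NeZero n]
    (h : IsUniformSampling μ i) {B : (ℕ → Fin n) → ℕ → F} (hB : DependsOnPast B) (t : ℕ) (f : Fin n → F → ℝ) :
    n * ∫ ω, f (i t ω) (B (fun s => i s ω) t) ∂μ
      = ∫ ω, ∑ j, f j (B (fun s => i s ω) t) ∂μ := by
  obtain ⟨β, hβ⟩ := hB.exists_factor t
  have hn : (n : ℝ) ≠ 0 := Nat.cast_ne_zero.2 (NeZero.ne n)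
  have hint : ∀ j, Integrable (fun ω => f j (B (fun s => i s ω) t)) μ :=
    fun j => h.integrable_comp hB t (f j)
  have hset : ∀ j, MeasurableSet {ω | i t ω = j} := fun j =>
    h.measurable t (measurableSet_singleton j)
  -- The event that `j` is drawn has probability `1 / n` and is independent of the past; summing
  -- over `j` gives the claim.
  have hone : ∀ j, (n : ℝ) * ∫ ω, f j (B (fun s => i s ω) t) * (if i t ω = j then 1 else 0) ∂μ
      = ∫ ω, f j (B (fun s => i s ω) t) ∂μ := by
    intro j
    have hind : IndepFun (fun ω => f j (B (fun s => i s ω) t))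
        (fun ω => if i t ω = j then (1 : ℝ) else 0) μ := by
      simp only [hβ]
      exact (h.indepFun_past t).comp (φ := fun r => f j (β r))
        (ψ := fun x => if x = j then (1 : ℝ) else 0)
        (measurable_of_countable _) (measurable_of_countable _)
    have hm : Measurable fun ω => if i t ω = j then (1 : ℝ) else 0 :=
      (measurable_of_countable (fun x : Fin n => if x = j then (1 : ℝ) else 0)).comp
        (h.measurable t)
    rw [hind.integral_fun_mul_eq_mul_integral (hint j).aestronglyMeasurable
      hm.aestronglyMeasurable]
    have : ∫ ω, (if i t ω = j then (1 : ℝ) else 0) ∂μ = (n : ℝ)⁻¹ := by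
      have e : (fun ω => if i t ω = j then (1 : ℝ) else 0)
          = Set.indicator {ω | i t ω = j} 1 := by
        ext ω
        simp [Set.indicator_apply]
      rw [e, integral_indicator_one (hset j), measureReal_def, h.uniform]
      simp
    rw [this]
    field_simp
  have hint' : ∀ j, Integrable
      (fun ω => f j (B (fun s => i s ω) t) * (if i t ω = j then 1 else 0)) μ := by
    intro j
    have := (hint j).indicator (hset j)
    refine this.congr (Filter.Eventually.of_forall fun ω => ?_)
    simp [Set.indicator_apply]
  rw [integral_finsetSum _ fun j _ => hint j, ← Finset.sum_congr rfl fun j _ => hone j,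
    ← Finset.mul_sum, ← integral_finsetSum _ fun j _ => hint' j]
  simp

end Sampling

/-! ### Diagonally dominant Gram matrices -/

section Gram

variable {n : ℕ} {K : Matrix (Fin n) (Fin n) ℝ}

theorem app_apply (K : Matrix (Fin n) (Fin n) ℝ) (v : EuclideanSpace ℝ (Fin n)) (j : Fin n) :
    app K v j = ∑ l, K j l * v l := rfl

theorem app_eq (K : Matrix (Fin n) (Fin n) ℝ) (v : EuclideanSpace ℝ (Fin n)) :
    app K v = WithLp.toLp 2 (K *ᵥ v.ofLp) := rfl

theorem app_smul (K : Matrix (Fin n) (Fin n) ℝ) (c : ℝ) (v : EuclideanSpace ℝ (Fin n)) :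
    app K (c • v) = c • app K v := by
  simp [app_eq, mulVec_smul]

theorem app_sub (K : Matrix (Fin n) (Fin n) ℝ) (v w : EuclideanSpace ℝ (Fin n)) :
    app K (v - w) = app K v - app K w := by
  simp [app_eq, mulVec_sub]

theorem inner_col (hK : K.IsHermitian) (j : Fin n) (v : EuclideanSpace ℝ (Fin n)) :
    inner ℝ (col K j) v = app K v j := by
  rw [app_apply, PiLp.inner_apply]
  refine Finset.sum_congr rfl fun l _ => ?_
  have : K l j = K j l := by simpa using hK.apply j l
  simp [col, this, mul_comm]

theorem col_eq_app_single (K : Matrix (Fin n) (Fin n) ℝ) (j : Fin n) :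
    col K j = app K (EuclideanSpace.single j 1) := by
  ext l
  simp [col, app_apply]

theorem inner_app_comm (hK : K.IsHermitian) (v w : EuclideanSpace ℝ (Fin n)) :
    inner ℝ v (app K w) = (inner ℝ (app K v) w : ℝ) := by
  simp only [PiLp.inner_apply, app_apply, RCLike.inner_apply, conj_trivial, Finset.mul_sum,
    Finset.sum_mul]
  rw [Finset.sum_comm]
  refine Finset.sum_congr rfl fun a _ => Finset.sum_congr rfl fun b _ => ?_
  have : K a b = K b a := by simpa using hK.apply b a
  rw [this]; ring

theorem norm_app_sq (hK : K.IsHermitian) (v : EuclideanSpace ℝ (Fin n)) :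
    ‖app K v‖ ^ 2 = ∑ j, (inner ℝ (col K j) v) ^ 2 := by
  rw [EuclideanSpace.norm_sq_eq]
  exact Finset.sum_congr rfl fun j _ => by rw [inner_col hK, Real.norm_eq_abs, sq_abs]

theorem sq_sum_abs_le (v : EuclideanSpace ℝ (Fin n)) : (∑ j, |v j|) ^ 2 ≤ n * ‖v‖ ^ 2 := by
  rw [EuclideanSpace.norm_sq_eq]
  simpa using sq_sum_le_card_mul_sum_sq (s := Finset.univ) (f := fun j => |v j|)

/-- The off-diagonal part of the quadratic form of `K` is at most `n τ ‖v‖²`. -/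
theorem abs_inner_app_sub_le {τ : ℝ} (hτ : 0 ≤ τ) (hoff : ∀ i j, i ≠ j → |K i j| ≤ τ)
    (v : EuclideanSpace ℝ (Fin n)) :
    |inner ℝ v (app K v) - ∑ j, K j j * v j ^ 2| ≤ n * τ * ‖v‖ ^ 2 := by
  have e : inner ℝ v (app K v) - ∑ j, K j j * v j ^ 2
      = ∑ j, ∑ l, (if j = l then 0 else v j * K j l * v l) := by
    rw [PiLp.inner_apply, ← Finset.sum_sub_distrib]
    refine Finset.sum_congr rfl fun j _ => ?_
    rw [app_apply, ← Finset.add_sum_erase _ _ (Finset.mem_univ j),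
      ← Finset.add_sum_erase (a := j) (f := fun l => if j = l then 0 else v j * K j l * v l) _
        (Finset.mem_univ j), if_pos rfl, RCLike.inner_apply, conj_trivial, zero_add, add_mul,
      Finset.sum_mul]
    rw [Finset.sum_congr rfl (g := fun l => if j = l then 0 else v j * K j l * v l)]
    · ring
    · intro l hl
      rw [if_neg (Finset.ne_of_mem_erase hl).symm]
      ring
  rw [e]
  calc |∑ j, ∑ l, (if j = l then 0 else v j * K j l * v l)|
      ≤ ∑ j, ∑ l, |if j = l then 0 else v j * K j l * v l| :=
        (Finset.abs_sum_le_sum_abs _ _).trans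
          (Finset.sum_le_sum fun j _ => Finset.abs_sum_le_sum_abs _ _)
    _ ≤ ∑ j, ∑ l, τ * (|v j| * |v l|) := by
        refine Finset.sum_le_sum fun j _ => Finset.sum_le_sum fun l _ => ?_
        split_ifs with hjl
        · simpa using by positivity
        · rw [abs_mul, abs_mul]
          nlinarith [hoff j l hjl, mul_nonneg (abs_nonneg (v j)) (abs_nonneg (v l))]
    _ = τ * (∑ j, |v j|) ^ 2 := by
        rw [sq, Finset.sum_mul_sum, Finset.mul_sum]
        simp only [Finset.mul_sum]
    _ ≤ n * τ * ‖v‖ ^ 2 := by nlinarith [sq_sum_abs_le v]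

theorem le_inner_app {τ c : ℝ} (hτ : 0 ≤ τ) (hoff : ∀ i j, i ≠ j → |K i j| ≤ τ)
    (hd : ∀ j, c ≤ K j j) (v : EuclideanSpace ℝ (Fin n)) :
    (c - n * τ) * ‖v‖ ^ 2 ≤ inner ℝ v (app K v) := by
  have h1 := (abs_le.1 (abs_inner_app_sub_le hτ hoff v)).1
  have h2 : c * ‖v‖ ^ 2 ≤ ∑ j, K j j * v j ^ 2 := by
    rw [EuclideanSpace.norm_sq_eq, Finset.mul_sum]
    refine Finset.sum_le_sum fun j _ => ?_
    rw [Real.norm_eq_abs, sq_abs]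
    exact mul_le_mul_of_nonneg_right (hd j) (sq_nonneg _)
  linarith

theorem inner_app_le {τ l : ℝ} (hτ : 0 ≤ τ) (hoff : ∀ i j, i ≠ j → |K i j| ≤ τ)
    (hd : ∀ j, K j j ≤ l) (v : EuclideanSpace ℝ (Fin n)) :
    inner ℝ v (app K v) ≤ (l + n * τ) * ‖v‖ ^ 2 := by
  have h1 := (abs_le.1 (abs_inner_app_sub_le hτ hoff v)).2
  have h2 : ∑ j, K j j * v j ^ 2 ≤ l * ‖v‖ ^ 2 := by
    rw [EuclideanSpace.norm_sq_eq, Finset.mul_sum]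
    refine Finset.sum_le_sum fun j _ => ?_
    rw [Real.norm_eq_abs, sq_abs]
    exact mul_le_mul_of_nonneg_right (hd j) (sq_nonneg _)
  linarith

theorem le_norm_app {τ c : ℝ} (hτ : 0 ≤ τ) (hoff : ∀ i j, i ≠ j → |K i j| ≤ τ)
    (hd : ∀ j, c ≤ K j j) (v : EuclideanSpace ℝ (Fin n)) :
    (c - n * τ) * ‖v‖ ≤ ‖app K v‖ := by
  rcases eq_or_ne v 0 with rfl | hv
  · simp
  have h := (le_inner_app hτ hoff hd v).trans (real_inner_le_norm _ _)
  have hv' : 0 < ‖v‖ := norm_pos_iff.2 hv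
  refine le_of_mul_le_mul_left ?_ hv'
  nlinarith

theorem inner_eigenvectorBasis_app (hK : K.IsHermitian) (j : Fin n)
    (v : EuclideanSpace ℝ (Fin n)) :
    inner ℝ (hK.eigenvectorBasis j) (app K v)
      = hK.eigenvalues j * (inner ℝ (hK.eigenvectorBasis j) v : ℝ) := by
  rw [inner_app_comm hK, app_eq, hK.mulVec_eigenvectorBasis, WithLp.toLp_smul, WithLp.toLp_ofLp,
    inner_smul_left]
  simp

theorem norm_app_le (hK : K.PosSemidef) (v : EuclideanSpace ℝ (Fin n)) :
    ‖app K v‖ ≤ (⨆ j, hK.isHermitian.eigenvalues j) * ‖v‖ := by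
  set γ := ⨆ j, hK.isHermitian.eigenvalues j
  have hle : ∀ j, hK.isHermitian.eigenvalues j ≤ γ :=
    fun j => le_ciSup (Set.finite_range _).bddAbove j
  have hγ : 0 ≤ γ := Real.iSup_nonneg fun j => hK.eigenvalues_nonneg j
  refine le_of_sq_le_sq ?_ (by positivity)
  rw [mul_pow, ← hK.isHermitian.eigenvectorBasis.sum_sq_norm_inner_right,
    ← hK.isHermitian.eigenvectorBasis.sum_sq_norm_inner_right v, Finset.mul_sum]
  refine Finset.sum_le_sum fun j _ => ?_
  rw [inner_eigenvectorBasis_app, norm_mul, mul_pow]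
  refine mul_le_mul_of_nonneg_right ?_ (sq_nonneg _)
  rw [Real.norm_eq_abs, sq_abs]
  exact pow_le_pow_left₀ (hK.eigenvalues_nonneg j) (hle j) 2

theorem iSup_eigenvalues_le [NeZero n] (hK : K.PosSemidef) {τ l : ℝ} (hτ : 0 ≤ τ)
    (hoff : ∀ i j, i ≠ j → |K i j| ≤ τ) (hd : ∀ j, K j j ≤ l) :
    ⨆ j, hK.isHermitian.eigenvalues j ≤ l + n * τ := by
  refine ciSup_le fun j => ?_
  have h := inner_app_le hτ hoff hd (hK.isHermitian.eigenvectorBasis j)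
  rw [inner_eigenvectorBasis_app, real_inner_self_eq_norm_sq,
    hK.isHermitian.eigenvectorBasis.norm_eq_one] at h
  simpa using h

theorem le_iSup_eigenvalues (hK : K.PosSemidef) (j : Fin n) :
    K j j ≤ ⨆ j, hK.isHermitian.eigenvalues j := by
  have h := norm_app_le hK (EuclideanSpace.single j 1)
  have h2 := PiLp.norm_apply_le (app K (EuclideanSpace.single j (1 : ℝ))) j
  have h3 : app K (EuclideanSpace.single j (1 : ℝ)) j = K j j := by
    rw [← col_eq_app_single]; rfl
  rw [h3] at h2
  simp at h
  exact (le_abs_self _).trans (h2.trans h)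

theorem app_nonsing_inv (hdet : IsUnit K.det) (v : EuclideanSpace ℝ (Fin n)) :
    app K (app K⁻¹ v) = v := by
  simp [app_eq, mulVec_mulVec, mul_nonsing_inv K hdet]

theorem isUnit_det_of_le_norm_app {c : ℝ} (hc : 0 < c)
    (h : ∀ v, c * ‖v‖ ≤ ‖app K v‖) : IsUnit K.det := by
  rw [← isUnit_iff_isUnit_det, ← mulVec_injective_iff_isUnit]
  intro x y hxy
  have h1 := h (WithLp.toLp 2 (x - y))
  have h2 : app K (WithLp.toLp 2 (x - y)) = 0 := by
    simp [app_eq, mulVec_sub, sub_eq_zero.2 hxy]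
  rw [h2, norm_zero] at h1
  have h3 : WithLp.toLp 2 (x - y) = (0 : EuclideanSpace ℝ (Fin n)) :=
    norm_eq_zero.1 (le_antisymm (by nlinarith) (norm_nonneg _))
  have h4 := congrArg WithLp.ofLp h3
  simpa [sub_eq_zero] using h4

theorem err_zero (K : Matrix (Fin n) (Fin n) ℝ) (y α₀ : EuclideanSpace ℝ (Fin n))
    (η₁ η₂ : ℝ) (k₁ : ℕ) (i : ℕ → Fin n) :
    err K y α₀ η₁ η₂ k₁ i 0 = α₀ - alphaHat K y := rfl

theorem err_succ (hK : K.IsHermitian) (hdet : IsUnit K.det) (y α₀ : EuclideanSpace ℝ (Fin n))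
    (η₁ η₂ : ℝ) (k₁ : ℕ) (i : ℕ → Fin n) (t : ℕ) :
    err K y α₀ η₁ η₂ k₁ i (t + 1)
      = relax (twoStage η₁ η₂ k₁ t) (col K (i t)) (err K y α₀ η₁ η₂ k₁ i t) := by
  have h : inner ℝ (col K (i t)) (alphaHat K y) = y (i t) := by
    rw [inner_col hK, alphaHat, app_nonsing_inv hdet]
  simp only [err, sgd, relax, inner_sub_right, h]
  abel

theorem norm_col_sq_le {τ : ℝ} (hoff : ∀ i j, i ≠ j → |K i j| ≤ τ) (j : Fin n) :
    ‖col K j‖ ^ 2 ≤ K j j ^ 2 + n * τ ^ 2 := by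
  rw [EuclideanSpace.norm_sq_eq, ← Finset.add_sum_erase _ _ (Finset.mem_univ j)]
  have h1 : ∑ l ∈ Finset.univ.erase j, ‖col K j l‖ ^ 2
      ≤ ∑ l ∈ Finset.univ.erase j, τ ^ 2 :=
    Finset.sum_le_sum fun l hl =>
      pow_le_pow_left₀ (norm_nonneg _) (hoff l j (Finset.ne_of_mem_erase hl)) 2
  have h2 : ∑ l ∈ Finset.univ.erase j, τ ^ 2 ≤ n * τ ^ 2 := by
    rw [Finset.sum_const, nsmul_eq_mul]
    have : ((Finset.univ.erase j).card : ℝ) ≤ n := by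
      exact_mod_cast (Finset.card_le_univ _).trans_eq (Fintype.card_fin n)
    exact mul_le_mul_of_nonneg_right this (sq_nonneg _)
  have h3 : ‖col K j j‖ ^ 2 = K j j ^ 2 := by simp [col]
  linarith

theorem sq_diag_le_norm_col_sq (K : Matrix (Fin n) (Fin n) ℝ) (j : Fin n) :
    K j j ^ 2 ≤ ‖col K j‖ ^ 2 := by
  have := PiLp.norm_apply_le (col K j) j
  have h3 : ‖col K j j‖ = |K j j| := by simp [col]
  rw [h3] at this
  rw [← sq_abs]
  exact pow_le_pow_left₀ (abs_nonneg _) this 2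

end Gram

/-! ### The direction orthogonal to all columns but one -/

section DualDirection

variable {n : ℕ} {K : Matrix (Fin n) (Fin n) ℝ}

theorem exists_unit_app_eq_smul_single {c : ℝ} (hc : 0 < c) (h : ∀ v, c * ‖v‖ ≤ ‖app K v‖)
    (j : Fin n) :
    ∃ (u : EuclideanSpace ℝ (Fin n)) (a : ℝ), ‖u‖ = 1 ∧ 0 < a ∧
      app K u = a • EuclideanSpace.single j 1 := by
  have hdet := isUnit_det_of_le_norm_app hc h
  set x := app K⁻¹ (EuclideanSpace.single j (1 : ℝ)) with hx
  have h1 : app K x = EuclideanSpace.single j 1 := app_nonsing_inv hdet _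
  have hx0 : x ≠ 0 := by
    intro h0
    have h2 := congrArg norm h1
    rw [h0] at h2
    simp [app_eq] at h2
  have hx' : 0 < ‖x‖ := norm_pos_iff.2 hx0
  refine ⟨‖x‖⁻¹ • x, ‖x‖⁻¹, ?_, by positivity, ?_⟩
  · rw [norm_smul, norm_inv, norm_norm, inv_mul_cancel₀ hx'.ne']
  · rw [app_smul, h1]

theorem inner_dual_col (hK : K.IsHermitian) {u : EuclideanSpace ℝ (Fin n)} {a : ℝ} {i₀ : Fin n}
    (hu : app K u = a • EuclideanSpace.single i₀ 1) (j : Fin n) :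
    inner ℝ u (col K j) = if j = i₀ then a else 0 := by
  rw [real_inner_comm, inner_col hK, hu]
  simp

/-- The direction orthogonal to all columns but one is close to that coordinate axis. -/
theorem norm_perp_dual_col_le {τ c l : ℝ} (hτ : 0 ≤ τ)
    (hoff : ∀ i j, i ≠ j → |K i j| ≤ τ) (hd : ∀ j, c ≤ K j j) (hc : 0 < c - n * τ)
    {u : EuclideanSpace ℝ (Fin n)} (hu1 : ‖u‖ = 1) {a : ℝ} {i₀ : Fin n}
    (hl : K i₀ i₀ ≤ l) (hl0 : 0 ≤ K i₀ i₀)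
    (hu : app K u = a • EuclideanSpace.single i₀ 1) :
    ‖perp u (col K i₀)‖ ≤ (l / (c - n * τ) + 1) * (√n * τ) := by
  set e : EuclideanSpace ℝ (Fin n) := EuclideanSpace.single i₀ 1 with he
  have he1 : ‖e‖ = 1 := by simp [he]
  have hev : ∀ v : EuclideanSpace ℝ (Fin n), inner ℝ e v = v i₀ := fun v => by
    simp [he, EuclideanSpace.inner_single_left]
  have hr : ‖perp e (col K i₀)‖ ≤ √n * τ := by
    refine le_of_sq_le_sq ?_ (by positivity)
    rw [norm_perp_sq he1, hev, mul_pow, Real.sq_sqrt (Nat.cast_nonneg n)]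
    have := norm_col_sq_le hoff i₀
    have h3 : col K i₀ i₀ = K i₀ i₀ := rfl
    rw [h3]
    linarith
  -- Both squares equal `1 - ⟪u, e⟫²`.
  have hsymm : ‖perp u e‖ = ‖perp e u‖ := by
    have h1 := norm_perp_sq hu1 e
    have h2 := norm_perp_sq he1 u
    rw [he1] at h1
    rw [hu1, real_inner_comm] at h2
    exact (sq_eq_sq₀ (norm_nonneg _) (norm_nonneg _)).1 (h1.trans h2.symm)
  -- Coercivity of `K` is tested on `perp e u`. Its image is `a • e` minus a multiple of the column;
  -- `e` pairs to zero with it, leaving only the off-diagonal part of the column.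
  have hu' : (c - n * τ) * ‖perp e u‖ ≤ √n * τ := by
    have h1 := le_inner_app hτ hoff hd (perp e u)
    have h2 : app K (perp e u) = a • e - (u i₀) • col K i₀ := by
      rw [perp, hev, app_sub, hu, app_smul, col_eq_app_single]
    have h3 : inner ℝ (perp e u) (app K (perp e u))
        = -(u i₀) * inner ℝ (perp e (col K i₀)) (perp e u) := by
      rw [h2, inner_sub_right, inner_smul_right, inner_smul_right, real_inner_comm e,
        inner_perp he1, inner_perp_perp he1, real_inner_comm (col K i₀)]
      ring
    have h4 : |u i₀| ≤ 1 := by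
      have := PiLp.norm_apply_le u i₀
      rwa [hu1] at this
    have h5 : inner ℝ (perp e u) (app K (perp e u)) ≤ √n * τ * ‖perp e u‖ := by
      rw [h3]
      refine (le_abs_self _).trans ?_
      rw [abs_mul, abs_neg]
      have h6 := abs_real_inner_le_norm (perp e (col K i₀)) (perp e u)
      have h7 : ‖perp e (col K i₀)‖ * ‖perp e u‖ ≤ √n * τ * ‖perp e u‖ := by gcongr
      calc |u i₀| * |(inner ℝ (perp e (col K i₀)) (perp e u) : ℝ)|
          ≤ 1 * |(inner ℝ (perp e (col K i₀)) (perp e u) : ℝ)| := by gcongr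
        _ ≤ _ := by linarith
    rcases eq_or_lt_of_le (norm_nonneg (perp e u)) with h0 | h0
    · rw [← h0, mul_zero]; positivity
    · refine le_of_mul_le_mul_right ?_ h0
      nlinarith
  have hdecomp : perp u (col K i₀) = (K i₀ i₀) • perp u e + perp u (perp e (col K i₀)) := by
    have h3 : inner ℝ e (col K i₀) = K i₀ i₀ := by rw [hev]; rfl
    simp only [perp, h3, inner_sub_right, inner_smul_right]
    module
  rw [hdecomp]
  refine (norm_add_le _ _).trans ?_
  rw [norm_smul, Real.norm_eq_abs, abs_of_nonneg hl0, hsymm]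
  have h8 : ‖perp e u‖ ≤ √n * τ / (c - n * τ) := by
    rw [le_div_iff₀ hc]; linarith
  have h9 : K i₀ i₀ * ‖perp e u‖ ≤ l * (√n * τ / (c - n * τ)) :=
    mul_le_mul hl h8 (norm_nonneg _) (hl0.trans hl)
  have h10 := (norm_perp_le hu1 (perp e (col K i₀))).trans hr
  have : (l / (c - n * τ) + 1) * (√n * τ) = l * (√n * τ / (c - n * τ)) + √n * τ := by ring
  linarith

/-- The full sum is `‖K z‖²`. The omitted term sees only the part of its column orthogonal to `u`,
since `z` is orthogonal to `u`. -/
theorem sum_erase_inner_col_sq_ge (hK : K.IsHermitian) {c₀ ω : ℝ} (hc₀ : 0 ≤ c₀)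
    (h : ∀ v, c₀ * ‖v‖ ≤ ‖app K v‖) {u : EuclideanSpace ℝ (Fin n)} (hu : ‖u‖ = 1) {i₀ : Fin n}
    (hω : ‖perp u (col K i₀)‖ ≤ ω) (z : EuclideanSpace ℝ (Fin n)) (hz : inner ℝ u z = (0 : ℝ)) :
    (c₀ ^ 2 - ω ^ 2) * ‖z‖ ^ 2
      ≤ ∑ j ∈ Finset.univ.erase i₀, (inner ℝ (col K j) z) ^ 2 := by
  have h1 := norm_app_sq hK z
  rw [← Finset.add_sum_erase _ _ (Finset.mem_univ i₀)] at h1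
  have h2 : c₀ ^ 2 * ‖z‖ ^ 2 ≤ ‖app K z‖ ^ 2 := by
    rw [← mul_pow]
    exact pow_le_pow_left₀ (by positivity) (h z) 2
  have h3 : (inner ℝ (col K i₀) z) ^ 2 ≤ ω ^ 2 * ‖z‖ ^ 2 := by
    have e : perp u z = z := by simp [perp, hz]
    have := abs_inner_perp_le hu (col K i₀) z
    rw [e] at this
    rw [← mul_pow, ← sq_abs]
    exact pow_le_pow_left₀ (abs_nonneg _) (this.trans (by gcongr)) 2
  linarith

/-- If `x` is orthogonal to the other columns, `K x` is a multiple of `e₀`, so `x` is a multiple of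
`u`. This turns the hypothesis on P₁ into a lower bound for the initial S. -/
theorem norm_projOne_le [NeZero n] (hK : K.IsHermitian) (hdet : IsUnit K.det)
    {u : EuclideanSpace ℝ (Fin n)} (hu1 : ‖u‖ = 1) {a : ℝ} (ha : 0 < a)
    (hu : app K u = a • EuclideanSpace.single 0 1) (v : EuclideanSpace ℝ (Fin n)) :
    ‖projOne K v‖ ≤ |(inner ℝ u v : ℝ)| := by
  set H := Submodule.span ℝ (col K '' {j | j ≠ 0}) with hH
  set x := projOne K v with hx
  have hxH : x ∈ Hᗮ := Submodule.sub_starProjection_mem_orthogonal v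
  have huH : u ∈ Hᗮ := by
    rw [Submodule.mem_orthogonal]
    intro w hw
    induction hw using Submodule.span_induction with
    | mem w hw =>
      obtain ⟨j, hj, rfl⟩ := hw
      rw [real_inner_comm, inner_dual_col hK hu, if_neg hj]
    | zero => simp
    | add y z _ _ hy hz => rw [inner_add_left, hy, hz, add_zero]
    | smul r y _ hy => rw [inner_smul_left, hy, mul_zero]
  have hux : (inner ℝ u x : ℝ) = inner ℝ u v := by
    have hPv : H.starProjection v ∈ H := Submodule.starProjection_apply_mem H v
    have h0 : (inner ℝ u (H.starProjection v) : ℝ) = 0 := by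
      rw [real_inner_comm]
      exact (Submodule.mem_orthogonal H u).1 huH _ hPv
    have hxv : x = v - H.starProjection v := rfl
    rw [hxv, inner_sub_right, h0, sub_zero]
  have happ : app K x = app K ((app K x 0 / a) • u) := by
    rw [app_smul, hu, smul_smul, div_mul_cancel₀ _ ha.ne']
    ext j
    rcases eq_or_ne j 0 with rfl | hj
    · simp
    · rw [← inner_col hK]
      have : inner ℝ (col K j) x = (0 : ℝ) :=
        (Submodule.mem_orthogonal H x).1 hxH _ (Submodule.subset_span ⟨j, hj, rfl⟩)
      rw [this]
      simp [hj]
  have hxu : x = (app K x 0 / a) • u := by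
    have hinj := mulVec_injective_iff_isUnit.2 ((isUnit_iff_isUnit_det K).2 hdet)
    have h1 := congrArg WithLp.ofLp happ
    have h2 := hinj h1
    exact (WithLp.ofLp_injective 2) h2
  generalize app K x 0 / a = t at hxu
  rw [← hux, hxu, inner_smul_right, real_inner_self_eq_norm_sq, norm_smul, hu1]
  simp

end DualDirection

/-! ### One step of the scalar ratio recursion -/

section Ratio

/-- One step of the recursion for the ratio of the mean transversal size `Z` to the mean dominant
component `S`. -/
theorem ratio_step {n μ ν V ζ g R S Z S' Z' : ℝ} (hn : 1 ≤ n) (hS : 0 < S) (hR : 0 ≤ R)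
    (hZR : Z ≤ R * S) (hg : 0 ≤ g) (hζ : 0 ≤ ζ) (hμ : μ ≤ n) (hνV : ν ≤ V) (hV : 0 ≤ V)
    (hν : -ζ ≤ ν) (hζR : ζ * (1 + R) ≤ 1 / 2) (hgap : g * (1 + V) + ζ * (R + 1) ≤ μ + ν)
    (hZ' : n * Z' ≤ (n - μ + ζ) * Z + ζ * S) (hS' : (n + ν) * S - ζ * Z ≤ n * S') :
    0 < S' ∧ Z' ≤ ((1 - g / n) * R + 2 * ζ / n) * S' := by
  have hn0 : 0 < n := by linarith
  have hgn : g ≤ n := by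
    have : g * V ≥ 0 := mul_nonneg hg hV
    have : 0 ≤ ζ * (R + 1) := by positivity
    by_contra hcon
    have h1 : 1 < g := by linarith
    nlinarith
  have hNl : -(1 / 2) ≤ ν - ζ * R := by linarith
  have h1 : (n + (ν - ζ * R)) * S ≤ n * S' := by nlinarith
  have h2 : n * Z' ≤ ((n - μ + ζ) * R + ζ) * S := by
    have : (n - μ + ζ) * Z ≤ (n - μ + ζ) * (R * S) :=
      mul_le_mul_of_nonneg_left hZR (by linarith)
    linarith
  have hS'0 : 0 < S' := by
    have : 0 < (n + (ν - ζ * R)) * S := mul_pos (by linarith) hS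
    exact pos_of_mul_pos_right (this.trans_le h1) hn0.le
  refine ⟨hS'0, ?_⟩
  -- The cross term `g R (ν - ζ R)` is absorbed by `n g R V`; this is why the gap hypothesis carries
  -- `g * (1 + V)` instead of `g`.
  have h3 : n * ((n - μ + ζ) * R + ζ) ≤ ((n - g) * R + 2 * ζ) * (n + (ν - ζ * R)) := by
    have e : ((n - g) * R + 2 * ζ) * (n + (ν - ζ * R)) - n * ((n - μ + ζ) * R + ζ)
        = n * R * (μ + ν - ζ - ζ * R - g * (1 + V)) + g * R * (n * V - (ν - ζ * R))
          + ζ * (n + 2 * (ν - ζ * R)) := by ring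
    have a1 : 0 ≤ n * R * (μ + ν - ζ - ζ * R - g * (1 + V)) :=
      mul_nonneg (by positivity) (by linarith)
    have a2 : 0 ≤ g * R * (n * V - (ν - ζ * R)) := by
      refine mul_nonneg (by positivity) ?_
      nlinarith [mul_nonneg hζ hR]
    have a3 : 0 ≤ ζ * (n + 2 * (ν - ζ * R)) := mul_nonneg hζ (by linarith)
    linarith
  have h4 : 0 ≤ (n - g) * R + 2 * ζ := by
    have : 0 ≤ (n - g) * R := mul_nonneg (by linarith) hR
    linarith
  have h5 : n * (n * Z') ≤ ((n - g) * R + 2 * ζ) * (n * S') := by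
    calc n * (n * Z') ≤ n * (((n - μ + ζ) * R + ζ) * S) := by gcongr
      _ = n * ((n - μ + ζ) * R + ζ) * S := by ring
      _ ≤ ((n - g) * R + 2 * ζ) * (n + (ν - ζ * R)) * S := by gcongr
      _ = ((n - g) * R + 2 * ζ) * ((n + (ν - ζ * R)) * S) := by ring
      _ ≤ _ := by gcongr
  have h6 : ((1 - g / n) * R + 2 * ζ / n) * S' = ((n - g) * R + 2 * ζ) * (n * S') / (n * n) := by
    field_simp
  rw [h6, le_div_iff₀ (by positivity)]
  linarith

end Ratio

/-! ### Iterating the ratio and the stage-one rates -/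

section Recursion

/-- The map `ρ ↦ (1 - g/n) ρ + 2ζ/n` has fixed point `2ζ/g`, which is the floor of the ratio. The
last step has no contraction to offer and is only bounded crudely. -/
theorem ratio_two_stage {S Z : ℕ → ℝ} {n μ ν V ζ g R : ℝ} {k : ℕ} (hn : 2 ≤ n) (hS : 0 < S 0)
    (hR : 0 ≤ R) (hZR : Z 0 ≤ R * S 0) (hg : 0 < g) (hg1 : g ≤ 1) (hζ : 0 ≤ ζ) (hμ : μ ≤ n)
    (hνV : ν ≤ V) (hV : 0 ≤ V) (hν : -ζ ≤ ν) (hζg : 2 * ζ ≤ g)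
    (hζR : ζ * (R + 3) ≤ 1 / 6) (hgap : g * (1 + V) + ζ * (R + 2) ≤ μ + ν)
    (hZ1 : ∀ t < k, n * Z (t + 1) ≤ (n - μ + ζ) * Z t + ζ * S t)
    (hS1 : ∀ t < k, (n + ν) * S t - ζ * Z t ≤ n * S (t + 1))
    (hZ2 : n * Z (k + 1) ≤ (n + ζ) * Z k + ζ * S k)
    (hS2 : (n - 1) * S k - ζ * Z k ≤ n * S (k + 1)) :
    0 < S (k + 1) ∧
      Z (k + 1) ≤ (6 * ((1 - g / n) ^ k * R + 2 * ζ / g) + 3 * ζ) * S (k + 1) := by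
  have hn0 : 0 < n := by linarith
  have hgn0 : 0 ≤ 1 - g / n := by
    rw [sub_nonneg, div_le_one hn0]; linarith
  have hgn1 : 1 - g / n ≤ 1 := by
    have : 0 ≤ g / n := by positivity
    linarith
  have hζg' : 2 * ζ / g ≤ 1 := by rw [div_le_one hg]; exact hζg
  have hζg0 : 0 ≤ 2 * ζ / g := by positivity
  have hRle : ∀ t : ℕ, (1 - g / n) ^ t * R + 2 * ζ / g ≤ R + 1 := fun t => by
    have : (1 - g / n) ^ t * R ≤ 1 * R :=
      mul_le_mul_of_nonneg_right (pow_le_one₀ hgn0 hgn1) hR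
    linarith
  have hR0 : ∀ t : ℕ, 0 ≤ (1 - g / n) ^ t * R + 2 * ζ / g := fun t => by positivity
  have key : ∀ t ≤ k, 0 < S t ∧ Z t ≤ ((1 - g / n) ^ t * R + 2 * ζ / g) * S t := by
    intro t
    induction t with
    | zero =>
      intro _
      refine ⟨hS, ?_⟩
      have := mul_nonneg hζg0 hS.le
      simp only [pow_zero, one_mul]
      linarith
    | succ t ih =>
      intro ht
      obtain ⟨hSt, hZt⟩ := ih (by omega)
      have h1 : ζ * ((1 - g / n) ^ t * R + 2 * ζ / g) ≤ ζ * (R + 1) :=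
        mul_le_mul_of_nonneg_left (hRle t) hζ
      obtain ⟨hS', hZ'⟩ := ratio_step (n := n) (μ := μ) (ν := ν) (V := V) (ζ := ζ) (g := g)
        (by linarith) hSt (hR0 t) hZt hg.le hζ hμ hνV hV hν (by linarith) (by linarith)
        (hZ1 t (by omega)) (hS1 t (by omega))
      refine ⟨hS', hZ'.trans_eq ?_⟩
      congr 1
      rw [pow_succ]
      field_simp
      ring
  obtain ⟨hSk, hZk⟩ := key k le_rfl
  set r := (1 - g / n) ^ k * R + 2 * ζ / g with hr
  have hr0 : 0 ≤ r := hR0 k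
  have hζr : ζ * r ≤ ζ * (R + 1) := mul_le_mul_of_nonneg_left (hRle k) hζ
  have hζR0 : 0 ≤ ζ * R := mul_nonneg hζ hR
  -- Here `2 ≤ n` matters: `(n - 1 - 1/6) / n ≥ 5/12 > 1/3`. Together with the at most doubled Z
  -- below, this gives the factor 6.
  have hS3 : S k ≤ 3 * S (k + 1) := by
    have h1 : ζ * Z k ≤ ζ * r * S k := by
      have := mul_le_mul_of_nonneg_left hZk hζ
      linarith
    have h2 : ζ * r * S k ≤ 1 / 6 * S k := mul_le_mul_of_nonneg_right (by linarith) hSk.le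
    have h3 : n * S k ≤ n * (3 * S (k + 1)) := by nlinarith
    exact le_of_mul_le_mul_left h3 hn0
  refine ⟨by linarith, ?_⟩
  have hZ3 : Z (k + 1) ≤ (2 * r + ζ) * S k := by
    refine le_of_mul_le_mul_left (hZ2.trans ?_) hn0
    have h1 : (n + ζ) * Z k ≤ (n + ζ) * (r * S k) :=
      mul_le_mul_of_nonneg_left hZk (by linarith)
    have h2 : 0 ≤ r * S k := mul_nonneg hr0 hSk.le
    have h3 : (n + ζ) * (r * S k) ≤ (2 * n) * (r * S k) :=
      mul_le_mul_of_nonneg_right (by linarith) h2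
    have h4 : ζ * S k ≤ n * (ζ * S k) := by
      have : 0 ≤ ζ * S k := mul_nonneg hζ hSk.le
      nlinarith
    linarith
  have h5 : (2 * r + ζ) * S k ≤ (2 * r + ζ) * (3 * S (k + 1)) :=
    mul_le_mul_of_nonneg_left hS3 (by linarith)
  linarith

/-- After order `n log (1/ε)` contractions by `1 - g/n`, the size `R` has shrunk below `ε / 100`. -/
theorem one_sub_div_pow_floor_mul_le {g n ε R : ℝ} {T : ℕ} (hg : 0 < g) (hg1 : g ≤ 1) (hn : 1 ≤ n)
    (hR : 0 ≤ R) (hT : R * (Real.exp 1 * 100) ≤ 2 ^ T) (hε : 0 < ε) (hε2 : ε ≤ 1 / 2) :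
    (1 - g / n) ^ ⌊(T + 1) / g * n * Real.log (1 / ε)⌋₊ * R ≤ ε / 100 := by
  set k := ⌊(T + 1) / g * n * Real.log (1 / ε)⌋₊ with hk
  have hn0 : 0 < n := by linarith
  have h1 : (1 - g / n) ^ k ≤ Real.exp (-(g / n)) ^ k := by
    refine pow_le_pow_left₀ ?_ (by linarith [Real.add_one_le_exp (-(g / n))]) k
    rw [sub_nonneg, div_le_one hn0]; linarith
  have h2 : (T + 1) / g * n * Real.log (1 / ε) < k + 1 := Nat.lt_floor_add_one _
  have h3 : k * -(g / n) ≤ 1 + (T + 1) * Real.log ε := by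
    -- Rounding down loses less than one contraction, which costs at most a factor `e`.
    have h4 : (T + 1) / g * n * Real.log (1 / ε) * (g / n) ≤ (k + 1) * (g / n) :=
      mul_le_mul_of_nonneg_right h2.le (by positivity)
    have h5 : (T + 1) / g * n * Real.log (1 / ε) * (g / n) = -((T + 1) * Real.log ε) := by
      rw [one_div, Real.log_inv]
      field_simp
    have h6 : g / n ≤ 1 := by rw [div_le_one hn0]; linarith
    linarith
  have h7 : Real.exp (-(g / n)) ^ k ≤ Real.exp 1 * ε ^ (T + 1) := by
    rw [← Real.exp_nat_mul]
    refine (Real.exp_le_exp.2 h3).trans_eq ?_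
    rw [Real.exp_add]
    congr 1
    rw [← Real.exp_log hε, ← Real.exp_nat_mul, Real.exp_log hε]
    push_cast
    rfl
  -- `T` of the factors `ε ≤ 1/2` beat the constant `100 e R`; the last one is kept.
  have h8 : ε ^ (T + 1) ≤ (1 / 2) ^ T * ε := by
    rw [pow_succ]
    gcongr
  have h9 : (1 - g / n) ^ k ≤ Real.exp 1 * ((1 / 2) ^ T * ε) :=
    (h1.trans h7).trans (by gcongr)
  calc (1 - g / n) ^ k * R ≤ Real.exp 1 * ((1 / 2) ^ T * ε) * R := by gcongr
    _ = (R * (Real.exp 1 * 100)) * ((1 / 2) ^ T * ε / 100) := by ring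
    _ ≤ 2 ^ T * ((1 / 2) ^ T * ε / 100) := by gcongr
    _ = ε / 100 := by
      rw [one_div, inv_pow]
      field_simp

/-- The growth rate `η l₁² - 2` and the contraction margin `2 - η (l₂² + s)` are both nonnegative
and sum to at least `η δ / 2`. Contraction enters with weight at least `κ ≤ 1`, so lowering the
weight of growth to `κ` and using `η ≥ 2 / Λ²` bounds the total from below; replacing `l₁²` by `a²`
costs `η ω²`. -/
theorem stage_one_gap {η c Λ δ l₁ l₂ s ω a : ℝ} (hc : 0 < c) (hcΛ : c ≤ Λ) (hl₁0 : 0 ≤ l₁)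
    (hl₁ : l₁ ≤ Λ) (hδ : 0 ≤ δ) (hgap : l₂ ^ 2 + δ ≤ l₁ ^ 2) (hη0 : 0 ≤ η) (hη1 : 2 ≤ η * l₁ ^ 2)
    (hη2 : η * (l₂ ^ 2 + s) ≤ 2) (hs : s ≤ δ / 2) (ha : l₁ ^ 2 - ω ^ 2 ≤ a ^ 2) :
    c ^ 2 / (4 * Λ ^ 2) * δ / Λ ^ 2 - η * ω ^ 2
      ≤ η * (2 - η * (l₂ ^ 2 + s)) / 2 * (c ^ 2 / 4) + (η * a ^ 2 - 2) := by
  have hΛ : 0 < Λ := by linarith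
  have hηΛ : 2 / Λ ^ 2 ≤ η := by
    rw [div_le_iff₀ (by positivity)]
    have : l₁ ^ 2 ≤ Λ ^ 2 := pow_le_pow_left₀ hl₁0 hl₁ 2
    nlinarith
  set x := 2 - η * (l₂ ^ 2 + s) with hx
  set κ := c ^ 2 / (4 * Λ ^ 2) with hκ
  have hx0 : 0 ≤ x := by linarith
  have hκ0 : 0 ≤ κ := by positivity
  have hκ1 : κ ≤ 1 := by
    rw [hκ, div_le_one (by positivity)]
    nlinarith
  have h1 : κ * x ≤ η * x / 2 * (c ^ 2 / 4) := by
    have : 2 / Λ ^ 2 * x ≤ η * x := mul_le_mul_of_nonneg_right hηΛ hx0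
    have e : κ * x = 2 / Λ ^ 2 * x / 2 * (c ^ 2 / 4) := by
      rw [hκ]; field_simp
    rw [e]
    gcongr
  have h2 : η * l₁ ^ 2 - 2 ≤ η * a ^ 2 - 2 + η * ω ^ 2 := by nlinarith
  have h3 : κ * (η * l₁ ^ 2 - 2) ≤ η * l₁ ^ 2 - 2 := by nlinarith
  have h4 : η * (δ / 2) - x ≤ η * l₁ ^ 2 - 2 := by nlinarith
  have h5 : κ * (η * (δ / 2) - x) ≤ κ * (η * l₁ ^ 2 - 2) := mul_le_mul_of_nonneg_left h4 hκ0
  have h6 : κ * δ / Λ ^ 2 ≤ κ * (η * (δ / 2)) := by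
    have : 2 / Λ ^ 2 * (κ * (δ / 2)) ≤ η * (κ * (δ / 2)) :=
      mul_le_mul_of_nonneg_right hηΛ (by positivity)
    have e : κ * δ / Λ ^ 2 = 2 / Λ ^ 2 * (κ * (δ / 2)) := by ring
    linarith
  linarith

/-- Merges finitely many smallness conditions on nτ into one threshold linear in `ε`. -/
theorem exists_pos_forall_mul_le (l : List ℝ) :
    ∃ p : ℝ, 0 < p ∧ ∀ q ε : ℝ, 0 ≤ q → q < p * ε → ∀ x ∈ l, x * q ≤ ε := by
  induction l with
  | nil => exact ⟨1, one_pos, by simp⟩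
  | cons y l ih =>
    obtain ⟨p, hp, h⟩ := ih
    have hy : 0 < |y| + 1 := by positivity
    refine ⟨min p (1 / (|y| + 1)), lt_min hp (by positivity), fun q ε hq hqp x hx => ?_⟩
    have hm : 0 < min p (1 / (|y| + 1)) := lt_min hp (by positivity)
    have hε : 0 < ε := pos_of_mul_pos_right (hq.trans_lt hqp) hm.le
    rcases List.mem_cons.1 hx with rfl | hx
    · have h1 : q ≤ 1 / (|x| + 1) * ε :=
        hqp.le.trans (mul_le_mul_of_nonneg_right (min_le_right _ _) hε.le)
      have h2 : x * q ≤ (|x| + 1) * q :=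
        mul_le_mul_of_nonneg_right (by linarith [le_abs_self x]) hq
      have h3 : (|x| + 1) * q ≤ (|x| + 1) * (1 / (|x| + 1) * ε) :=
        mul_le_mul_of_nonneg_left h1 hy.le
      have h4 : (|x| + 1) * (1 / (|x| + 1) * ε) = ε := by field_simp
      linarith
    · exact h q ε hq
        (hqp.trans_le (mul_le_mul_of_nonneg_right (min_le_left _ _) hε.le)) x hx

end Recursion

/-! ### Expected dynamics and the final quotient -/

section Gram

variable {n : ℕ} {K : Matrix (Fin n) (Fin n) ℝ}

theorem sqrt_natCast_le (n : ℕ) : √(n : ℝ) ≤ n := by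
  rw [Real.sqrt_le_left (Nat.cast_nonneg n)]
  exact_mod_cast Nat.le_self_pow two_ne_zero n

theorem exists_dual_frame [NeZero n] (hK : K.IsHermitian) {τ c Λ : ℝ} (hc : 0 < c) (hτ : 0 ≤ τ)
    (hoff : ∀ i j, i ≠ j → |K i j| ≤ τ) (hd : ∀ j, c ≤ K j j) (hΛ : K 0 0 ≤ Λ)
    (hsmall : (2 * Λ / c + 1) * (n * τ) ≤ c / 4) :
    ∃ (u : EuclideanSpace ℝ (Fin n)) (a : ℝ), ‖u‖ = 1 ∧ 0 < a ∧
      app K u = a • EuclideanSpace.single 0 1 ∧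
      ‖perp u (col K 0)‖ ≤ (2 * Λ / c + 1) * (n * τ) ∧
      K 0 0 ^ 2 - ‖perp u (col K 0)‖ ^ 2 ≤ a ^ 2 ∧ a ^ 2 ≤ ‖col K 0‖ ^ 2 ∧
      (∀ z, inner ℝ u z = (0 : ℝ) →
        c ^ 2 / 4 * ‖z‖ ^ 2 ≤ ∑ j ∈ Finset.univ.erase 0, (inner ℝ (col K j) z) ^ 2) := by
  have hq : 0 ≤ n * τ := by positivity
  have hΛ0 : 0 < Λ := (hc.trans_le (hd 0)).trans_le hΛ
  have hA : 0 ≤ 2 * Λ / c := by positivity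
  have hq4 : n * τ ≤ c / 4 := by nlinarith
  have hc₀ : 0 < c - n * τ := by linarith
  have hlow : ∀ v, (c - n * τ) * ‖v‖ ≤ ‖app K v‖ := le_norm_app hτ hoff hd
  obtain ⟨u, a, hu1, ha, hu⟩ := exists_unit_app_eq_smul_single hc₀ hlow 0
  have hsqrt := sqrt_natCast_le n
  have hω : ‖perp u (col K 0)‖ ≤ (2 * Λ / c + 1) * (n * τ) := by
    refine (norm_perp_dual_col_le hτ hoff hd hc₀ hu1 hΛ (hc.le.trans (hd 0)) hu).trans ?_
    have h1 : Λ / (c - n * τ) ≤ 2 * Λ / c := by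
      rw [div_le_div_iff₀ hc₀ hc]; nlinarith
    have h2 : √(n : ℝ) * τ ≤ n * τ := mul_le_mul_of_nonneg_right hsqrt hτ
    have h3 : 0 ≤ √(n : ℝ) * τ := by positivity
    exact mul_le_mul (by linarith) h2 h3 (by linarith)
  have hsq : ‖perp u (col K 0)‖ ^ 2 = ‖col K 0‖ ^ 2 - a ^ 2 := by
    rw [norm_perp_sq hu1, inner_dual_col hK hu, if_pos rfl]
  refine ⟨u, a, hu1, ha, hu, hω, ?_, ?_, fun z hz => ?_⟩
  · linarith [sq_diag_le_norm_col_sq K 0]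
  · nlinarith [sq_nonneg ‖perp u (col K 0)‖]
  · refine le_trans ?_ (sum_erase_inner_col_sq_ge hK hc₀.le hlow hu1 (hω.trans hsmall) z hz)
    refine mul_le_mul_of_nonneg_right ?_ (sq_nonneg _)
    -- The constant survives because `(3c/4)² - (c/4)² = c²/2`.
    have : (3 * c / 4) ^ 2 ≤ (c - n * τ) ^ 2 := pow_le_pow_left₀ (by positivity) (by linarith) 2
    nlinarith

/-- The mean of the dominant component and of the transversal size after one random step. -/
theorem expected_step [NeZero n] {Ω : Type*} [MeasurableSpace Ω] {μ : Measure Ω}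
    [IsProbabilityMeasure μ] {i : ℕ → Ω → Fin n} (hi : IsUniformSampling μ i)
    {B : (ℕ → Fin n) → ℕ → EuclideanSpace ℝ (Fin n)} (hB : DependsOnPast B) {t : ℕ} {η : ℝ}
    (hstep : ∀ x, B x (t + 1) = relax η (col K (x t)) (B x t))
    (hK : K.IsHermitian) {u : EuclideanSpace ℝ (Fin n)} (hu1 : ‖u‖ = 1) {a L σ : ℝ} (ha : 0 ≤ a)
    (hu : app K u = a • EuclideanSpace.single 0 1) (hη : 0 ≤ η)
    (hkL : ∀ j, j ≠ 0 → ‖col K j‖ ^ 2 ≤ L) (hL : η * L ≤ 2)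
    (hσ : ∀ z, inner ℝ u z = (0 : ℝ) →
      σ * ‖z‖ ^ 2 ≤ ∑ j ∈ Finset.univ.erase 0, (inner ℝ (col K j) z) ^ 2) :
    (n - 1 + |1 - η * a ^ 2|) * ∫ ω, |(inner ℝ u (B (fun s => i s ω) t) : ℝ)| ∂μ
        - η * a * ‖perp u (col K 0)‖ * ∫ ω, ‖perp u (B (fun s => i s ω) t)‖ ∂μ
      ≤ n * ∫ ω, |(inner ℝ u (B (fun s => i s ω) (t + 1)) : ℝ)| ∂μ ∧
    n * ∫ ω, ‖perp u (B (fun s => i s ω) (t + 1))‖ ∂μ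
      ≤ (n - η * (2 - η * L) / 2 * σ + η * ‖perp u (col K 0)‖ ^ 2)
          * ∫ ω, ‖perp u (B (fun s => i s ω) t)‖ ∂μ
        + η * a * ‖perp u (col K 0)‖
          * ∫ ω, |(inner ℝ u (B (fun s => i s ω) t) : ℝ)| ∂μ := by
  have hcol : ∀ j, j ≠ 0 → inner ℝ u (col K j) = (0 : ℝ) := fun j hj => by
    rw [inner_dual_col hK hu, if_neg hj]
  have hcol0 : inner ℝ u (col K 0) = a := by rw [inner_dual_col hK hu, if_pos rfl]
  have iS : Integrable (fun ω => |(inner ℝ u (B (fun s => i s ω) t) : ℝ)|) μ :=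
    hi.integrable_comp hB t fun v => |(inner ℝ u v : ℝ)|
  have iZ : Integrable (fun ω => ‖perp u (B (fun s => i s ω) t)‖) μ :=
    hi.integrable_comp hB t fun v => ‖perp u v‖
  simp only [hstep]
  rw [hi.integral_step hB t fun j v => |(inner ℝ u (relax η (col K j) v) : ℝ)|,
    hi.integral_step hB t fun j v => ‖perp u (relax η (col K j) v)‖]
  constructor
  · rw [← integral_const_mul, ← integral_const_mul, ← integral_sub (iS.const_mul _)
      (iZ.const_mul _)]
    refine integral_mono ((iS.const_mul _).sub (iZ.const_mul _))
      (hi.integrable_comp hB t fun v => ∑ j, |(inner ℝ u (relax η (col K j) v) : ℝ)|)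
      fun ω => ?_
    have := le_sum_abs_inner_relax hu1 hcol hη (hcol0.symm ▸ ha) (B (fun s => i s ω) t)
    rwa [hcol0, Fintype.card_fin] at this
  · rw [← integral_const_mul, ← integral_const_mul, ← integral_add (iZ.const_mul _)
      (iS.const_mul _)]
    refine integral_mono (hi.integrable_comp hB t fun v => ∑ j, ‖perp u (relax η (col K j) v)‖)
      ((iZ.const_mul _).add (iS.const_mul _)) fun ω => ?_
    have := sum_norm_perp_relax_le hu1 hcol hη (hcol0.symm ▸ ha) hkL hL hσ (B (fun s => i s ω) t)
    rwa [hcol0, Fintype.card_fin] at this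

/-- The bounds of `expected_step` with all couplings replaced by an upper bound `ζ`. -/
theorem expected_step_of_coupling_le [NeZero n] {Ω : Type*} [MeasurableSpace Ω] {μ : Measure Ω}
    [IsProbabilityMeasure μ] {i : ℕ → Ω → Fin n} (hi : IsUniformSampling μ i)
    {B : (ℕ → Fin n) → ℕ → EuclideanSpace ℝ (Fin n)} (hB : DependsOnPast B) {t : ℕ} {η : ℝ}
    (hstep : ∀ x, B x (t + 1) = relax η (col K (x t)) (B x t))
    (hK : K.IsHermitian) {u : EuclideanSpace ℝ (Fin n)} (hu1 : ‖u‖ = 1) {a L σ ζ m ν : ℝ}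
    (ha : 0 ≤ a) (hu : app K u = a • EuclideanSpace.single 0 1) (hη : 0 ≤ η)
    (hkL : ∀ j, j ≠ 0 → ‖col K j‖ ^ 2 ≤ L) (hL : η * L ≤ 2)
    (hσ : ∀ z, inner ℝ u z = (0 : ℝ) →
      σ * ‖z‖ ^ 2 ≤ ∑ j ∈ Finset.univ.erase 0, (inner ℝ (col K j) z) ^ 2)
    (hκ : η * a * ‖perp u (col K 0)‖ ≤ ζ) (he : η * ‖perp u (col K 0)‖ ^ 2 ≤ ζ)
    (hm : m ≤ η * (2 - η * L) / 2 * σ) (hν : ν ≤ |1 - η * a ^ 2| - 1) :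
    n * ∫ ω, ‖perp u (B (fun s => i s ω) (t + 1))‖ ∂μ
      ≤ (n - m + ζ) * ∫ ω, ‖perp u (B (fun s => i s ω) t)‖ ∂μ
        + ζ * ∫ ω, |(inner ℝ u (B (fun s => i s ω) t) : ℝ)| ∂μ ∧
    (n + ν) * ∫ ω, |(inner ℝ u (B (fun s => i s ω) t) : ℝ)| ∂μ
        - ζ * ∫ ω, ‖perp u (B (fun s => i s ω) t)‖ ∂μ
      ≤ n * ∫ ω, |(inner ℝ u (B (fun s => i s ω) (t + 1)) : ℝ)| ∂μ := by
  obtain ⟨h1, h2⟩ := expected_step hi hB hstep hK hu1 ha hu hη hkL hL hσ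
  have hS : 0 ≤ ∫ ω, |(inner ℝ u (B (fun s => i s ω) t) : ℝ)| ∂μ :=
    integral_nonneg fun ω => abs_nonneg _
  have hZ : 0 ≤ ∫ ω, ‖perp u (B (fun s => i s ω) t)‖ ∂μ := integral_nonneg fun ω => norm_nonneg _
  constructor
  · refine h2.trans (add_le_add (mul_le_mul_of_nonneg_right ?_ hZ)
      (mul_le_mul_of_nonneg_right hκ hS))
    linarith
  · refine le_trans (sub_le_sub (mul_le_mul_of_nonneg_right ?_ hS)
      (mul_le_mul_of_nonneg_right hκ hZ)) h1
    linarith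

/-- The Rayleigh-type quotient of mean norms is controlled by the ratio of the mean transversal size
to the mean dominant component. -/
theorem quotient_bounds {Ω : Type*} [MeasurableSpace Ω] {μ : Measure Ω} (hK : K.PosSemidef)
    {u : EuclideanSpace ℝ (Fin n)} (hu1 : ‖u‖ = 1) {a ε : ℝ} {i₀ : Fin n} (ha : 0 ≤ a)
    (hu : app K u = a • EuclideanSpace.single i₀ 1) {b : Ω → EuclideanSpace ℝ (Fin n)}
    (hb : ∀ f : EuclideanSpace ℝ (Fin n) → ℝ, Integrable (fun ω => f (b ω)) μ) (hε : 0 < ε)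
    (haγ : (1 - ε / 4) * (⨆ j, hK.isHermitian.eigenvalues j) ≤ a)
    (hS : 0 < ∫ ω, |(inner ℝ u (b ω) : ℝ)| ∂μ)
    (hZ : ε < 1 / 2 →
      ∫ ω, ‖perp u (b ω)‖ ∂μ ≤ ε / 4 * ∫ ω, |(inner ℝ u (b ω) : ℝ)| ∂μ) :
    0 < ∫ ω, ‖b ω‖ ∂μ ∧
    (1 - 2 * ε) * (⨆ j, hK.isHermitian.eigenvalues j)
      ≤ (∫ ω, ‖app K (b ω)‖ ∂μ) / (∫ ω, ‖b ω‖ ∂μ) ∧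
    (∫ ω, ‖app K (b ω)‖ ∂μ) / (∫ ω, ‖b ω‖ ∂μ) ≤ ⨆ j, hK.isHermitian.eigenvalues j := by
  set γ := ⨆ j, hK.isHermitian.eigenvalues j
  have hγ : 0 ≤ γ := Real.iSup_nonneg fun j => hK.eigenvalues_nonneg j
  have iS := hb fun v => |(inner ℝ u v : ℝ)|
  have iZ := hb fun v => ‖perp u v‖
  have iN := hb fun v => ‖v‖
  have iK := hb fun v => ‖app K v‖
  have h1 : ∫ ω, |(inner ℝ u (b ω) : ℝ)| ∂μ ≤ ∫ ω, ‖b ω‖ ∂μ :=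
    integral_mono iS iN fun ω => by
      have := abs_real_inner_le_norm u (b ω)
      rwa [hu1, one_mul] at this
  have h2 : ∫ ω, ‖b ω‖ ∂μ ≤ ∫ ω, ‖perp u (b ω)‖ ∂μ + ∫ ω, |(inner ℝ u (b ω) : ℝ)| ∂μ := by
    rw [← integral_add iZ iS]
    refine integral_mono iN (iZ.add iS) fun ω => ?_
    have := norm_add_le (perp u (b ω)) ((inner ℝ u (b ω) : ℝ) • u)
    rwa [perp_add_smul, norm_smul, hu1, mul_one, Real.norm_eq_abs] at this
  have h3 : a * ∫ ω, |(inner ℝ u (b ω) : ℝ)| ∂μ - γ * ∫ ω, ‖perp u (b ω)‖ ∂μ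
      ≤ ∫ ω, ‖app K (b ω)‖ ∂μ := by
    rw [← integral_const_mul, ← integral_const_mul, ← integral_sub (iS.const_mul _)
      (iZ.const_mul _)]
    refine integral_mono ((iS.const_mul _).sub (iZ.const_mul _)) iK fun ω => ?_
    -- Apply the reverse triangle inequality to `K b = ⟪u, b⟫ a e + K (perp u b)`.
    have e : (inner ℝ u (b ω) : ℝ) • app K u = app K (b ω) - app K (perp u (b ω)) := by
      rw [← app_sub, ← app_smul]
      congr 1
      simp [perp]
    have h4 := norm_sub_le (app K (b ω)) (app K (perp u (b ω)))
    rw [← e, hu, norm_smul, norm_smul, Real.norm_eq_abs, Real.norm_eq_abs, abs_of_nonneg ha] at h4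
    have h5 := norm_app_le hK (perp u (b ω))
    simp only [PiLp.norm_single, norm_one, mul_one] at h4
    change a * _ - γ * _ ≤ _
    linarith
  have h4 : ∫ ω, ‖app K (b ω)‖ ∂μ ≤ γ * ∫ ω, ‖b ω‖ ∂μ := by
    rw [← integral_const_mul]
    exact integral_mono iK (iN.const_mul _) fun ω => norm_app_le hK (b ω)
  have hpos : 0 < ∫ ω, ‖b ω‖ ∂μ := hS.trans_le h1
  refine ⟨hpos, ?_, (div_le_iff₀ hpos).2 h4⟩
  -- For `ε ≥ 1/2` the lower bound is nonpositive, so smallness of Z is not needed.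
  rcases lt_or_ge ε (1 / 2) with hε2 | hε2
  · rw [le_div_iff₀ hpos]
    have hZ' := hZ hε2
    set S := ∫ ω, |(inner ℝ u (b ω) : ℝ)| ∂μ
    set Z := ∫ ω, ‖perp u (b ω)‖ ∂μ
    set N := ∫ ω, ‖b ω‖ ∂μ
    have h5 : (1 - 2 * ε) * γ * N ≤ (1 - 2 * ε) * γ * ((1 + ε / 4) * S) :=
      mul_le_mul_of_nonneg_left (by linarith) (mul_nonneg (by linarith) hγ)
    have h6 : (1 - ε / 4) * γ * S ≤ a * S := mul_le_mul_of_nonneg_right haγ hS.le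
    have h7 : γ * Z ≤ γ * (ε / 4 * S) := mul_le_mul_of_nonneg_left hZ' hγ
    have h8 : 0 ≤ γ * S * (5 * ε / 4 + ε ^ 2 / 2) :=
      mul_nonneg (mul_nonneg hγ hS.le) (by positivity)
    nlinarith
  · refine le_trans (mul_nonpos_of_nonpos_of_nonneg (by linarith) hγ) ?_
    exact div_nonneg (integral_nonneg fun ω => norm_nonneg _) hpos.le

end Gram

theorem coupling_le {η c Λ A q ω a : ℝ} (hc : 0 < c) (hcΛ : c ≤ Λ)
    (hη : η ≤ 2 / c ^ 2) (hω0 : 0 ≤ ω) (hω : ω ≤ A * q) (hAq : A * q ≤ c / 4) (ha0 : 0 ≤ a)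
    (ha : a ^ 2 ≤ 2 * Λ ^ 2) :
    η * a * ω ≤ 4 * Λ * A / c ^ 2 * q ∧ η * ω ^ 2 ≤ 4 * Λ * A / c ^ 2 * q := by
  have hΛ : 0 < Λ := hc.trans_le hcΛ
  have ha2 : a ≤ 2 * Λ := le_of_sq_le_sq (by nlinarith) (by positivity)
  have e : 4 * Λ * A / c ^ 2 * q = 2 / c ^ 2 * (2 * Λ) * (A * q) := by ring
  have hω2 : ω ≤ 2 * Λ := by linarith
  constructor
  · rw [e]; gcongr
  · rw [e, sq ω, ← mul_assoc]; gcongr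

/-- The margin `C₂ r` is linear in `r`, while a column's squared norm exceeds the squared diagonal
entry by at most `r²`; hence `r ≤ C₂` is enough. The condition on `C₁` keeps the denominator
positive. -/
theorem stage_one_step_size {η c l₁ l₂ C₁ C₂ r : ℝ} (hc : 0 < c) (hl₁ : c ≤ l₁) (hl₂ : c ≤ l₂)
    (hC₁ : 0 < C₁) (hC₂ : 0 < C₂) (hr : 0 ≤ r) (hrC₁ : C₁ * r ≤ c ^ 2 / 2) (hrC₂ : r ≤ C₂)
    (h1 : 2 / (l₁ ^ 2 - C₁ * r) < η) (h2 : η < 2 / (l₂ ^ 2 + C₂ * r)) :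
    0 ≤ η ∧ 2 ≤ η * l₁ ^ 2 ∧ η * (l₂ ^ 2 + r ^ 2) ≤ 2 ∧ η ≤ 2 / c ^ 2 := by
  have hc1 : c ^ 2 ≤ l₁ ^ 2 := pow_le_pow_left₀ hc.le hl₁ 2
  have hc2 : c ^ 2 ≤ l₂ ^ 2 := pow_le_pow_left₀ hc.le hl₂ 2
  have hcc : 0 < c ^ 2 := by positivity
  have hCr : 0 ≤ C₁ * r := by positivity
  have hCr2 : 0 ≤ C₂ * r := by positivity
  have hden : 0 < l₁ ^ 2 - C₁ * r := by linarith
  have hη : 0 < η := lt_trans (by positivity) h1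
  rw [div_lt_iff₀ hden] at h1
  rw [lt_div_iff₀ (by linarith)] at h2
  refine ⟨hη.le, by nlinarith, ?_, ?_⟩
  · have : r ^ 2 ≤ C₂ * r := by nlinarith
    nlinarith
  · rw [le_div_iff₀ hcc]
    nlinarith

theorem stage_two_step_size {η c l₁ C₃ r : ℝ} (hc : 0 < c) (hl₁ : c ≤ l₁)
    (hC₃ : 0 < C₃) (hr : 0 ≤ r) (hrC₃ : r ≤ C₃) (h0 : 0 < η) (h : η < 1 / (l₁ ^ 2 + C₃ * r)) :
    η * (l₁ ^ 2 + r ^ 2) ≤ 1 ∧ η ≤ 2 / c ^ 2 := by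
  have hc1 : c ^ 2 ≤ l₁ ^ 2 := pow_le_pow_left₀ hc.le hl₁ 2
  have hcc : 0 < c ^ 2 := by positivity
  have hCr : 0 ≤ C₃ * r := by positivity
  rw [lt_div_iff₀ (by linarith)] at h
  constructor
  · have : r ^ 2 ≤ C₃ * r := by nlinarith
    nlinarith
  · rw [le_div_iff₀ hcc]
    nlinarith

end KernelSGD

/-! ### Choice of constants and assembly -/

theorem theorem1
    (c₁ c₂ δ β₀ M C₁ C₂ C₃ : ℝ) (hc₁ : 0 < c₁) (hδ : 0 < δ) (hβ₀ : 0 < β₀)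
    (hC₁ : 0 < C₁) (hC₂ : 0 < C₂) (hC₃ : 0 < C₃) :
    -- `p ε ^ m` is the polynomial bound on `n τ`, and `C` the constant of `k₁ = O(n log (1/ε))`
    ∃ (p C : ℝ) (m : ℕ), 0 < p ∧ 0 < C ∧ 0 < m ∧
      ∀ (n : ℕ) [NeZero n], 2 ≤ n →
      ∀ (K : Matrix (Fin n) (Fin n) ℝ) (hK : K.PosSemidef) (τ : ℝ),
        -- the diagonal entries `λ_i = K i i` are ordered, and lie in `[c₁, c₂]`
        Antitone (fun i => K i i) → (∀ i, c₁ ≤ K i i) → (∀ i, K i i ≤ c₂) →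
        -- the gap between `λ₁` and `λ₂`
        K 1 1 ^ 2 + δ ≤ K 0 0 ^ 2 →
        -- diagonal dominance
        (∀ i j, i ≠ j → |K i j| ≤ τ) →
      ∀ (y α₀ : EuclideanSpace ℝ (Fin n)),
        -- the initial error `b₀` is bounded, and `P₁ b₀` is away from zero
        ‖α₀ - KernelSGD.alphaHat K y‖ ≤ M →
        β₀ ≤ ‖KernelSGD.projOne K (α₀ - KernelSGD.alphaHat K y)‖ →
      ∀ η₁ η₂ : ℝ,
        2 / (K 0 0 ^ 2 - C₁ * √n * τ) < η₁ → η₁ < 2 / (K 1 1 ^ 2 + C₂ * √n * τ) →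
        0 < η₂ → η₂ < 1 / (K 0 0 ^ 2 + C₃ * √n * τ) →
      ∀ ε : ℝ, 0 < ε → ε < 1 → n * τ < p * ε ^ m →
      ∃ k₁ k₂ : ℕ, k₁ < k₂ ∧ (k₁ : ℝ) ≤ C * n * Real.log (1 / ε) ∧
        ∀ (Ω : Type*) [MeasurableSpace Ω] (μ : Measure Ω) [IsProbabilityMeasure μ]
          (i : ℕ → Ω → Fin n), KernelSGD.IsUniformSampling μ i →
          let b : Ω → EuclideanSpace ℝ (Fin n) :=
            fun ω => KernelSGD.err K y α₀ η₁ η₂ k₁ (fun t => i t ω) k₂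
          let γ₁ : ℝ := ⨆ j, hK.isHermitian.eigenvalues j
          0 < ∫ ω, ‖b ω‖ ∂μ ∧
          (1 - 2 * ε) * γ₁ ≤ (∫ ω, ‖KernelSGD.app K (b ω)‖ ∂μ) / (∫ ω, ‖b ω‖ ∂μ) ∧
          (∫ ω, ‖KernelSGD.app K (b ω)‖ ∂μ) / (∫ ω, ‖b ω‖ ∂μ) ≤ γ₁ := by
  obtain ⟨Λ, hcΛ, hc₂Λ⟩ : ∃ Λ, c₁ ≤ Λ ∧ c₂ ≤ Λ := ⟨max c₁ c₂, le_max_left _ _, le_max_right _ _⟩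
  have hΛ : 0 < Λ := hc₁.trans_le hcΛ
  obtain ⟨A, hA⟩ : ∃ A, A = 2 * Λ / c₁ + 1 := ⟨_, rfl⟩
  have hA0 : 0 < A := by rw [hA]; positivity
  obtain ⟨β, hβ⟩ : ∃ β, β = 4 * Λ * A / c₁ ^ 2 := ⟨_, rfl⟩
  have hβ0 : 0 < β := by rw [hβ]; positivity
  obtain ⟨G, hG⟩ : ∃ G, G = c₁ ^ 2 / (4 * Λ ^ 2) * δ / Λ ^ 2 := ⟨_, rfl⟩
  have hG0 : 0 < G := by rw [hG]; positivity
  obtain ⟨V, hV⟩ : ∃ V, V = 4 * Λ ^ 2 / c₁ ^ 2 := ⟨_, rfl⟩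
  have hV0 : 0 < V := by rw [hV]; positivity
  -- Half of the gap `G` pays for `g (1 + V)`, the other half for the couplings.
  obtain ⟨g, hg⟩ : ∃ g, g = G / (2 * (1 + V)) := ⟨_, rfl⟩
  have hg0 : 0 < g := by rw [hg]; positivity
  obtain ⟨R, hR⟩ : ∃ R, R = |M| / β₀ := ⟨_, rfl⟩
  have hR0 : 0 ≤ R := by rw [hR]; positivity
  obtain ⟨T, hT⟩ := pow_unbounded_of_one_lt (R * (Real.exp 1 * 100)) (one_lt_two : (1 : ℝ) < 2)
  obtain ⟨p, hp, hsmall⟩ := KernelSGD.exists_pos_forall_mul_le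
    [1, 2 / δ, 1 / Λ ^ 2, 4 * A / c₁, 2 * C₁ / c₁ ^ 2, 1 / C₂, 1 / C₃, 2 * β * (R + 3) / G,
      6 * β * (R + 3), 100 * β / g, 100 * β, 4 * (1 + A) / c₁]
  refine ⟨p, (T + 1) / g, 1, hp, by positivity, one_pos, ?_⟩
  intro n _ hn K hK τ hanti hd hd₂ hgap hoff y α₀ hM hβ₀P η₁ η₂ hη₁l hη₁u hη₂0 hη₂u ε hε hε1 hq
  rw [pow_one] at hq
  have hH := hK.isHermitian
  have hn2 : (2 : ℝ) ≤ n := by exact_mod_cast hn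
  have hτ : 0 ≤ τ := by
    have h01 : (0 : Fin n) ≠ 1 := by
      intro h
      have := congrArg Fin.val h
      rw [Fin.val_zero, Fin.val_one', Nat.mod_eq_of_lt hn] at this
      omega
    exact (abs_nonneg _).trans (hoff 0 1 h01)
  obtain ⟨q, hqdef⟩ : ∃ q, q = n * τ := ⟨_, rfl⟩
  have hq0 : 0 ≤ q := by rw [hqdef]; positivity
  rw [← hqdef] at hq
  have hs := hsmall q ε hq0 hq
  simp only [List.forall_mem_cons, List.not_mem_nil, false_imp_iff, implies_true, and_true] at hs
  obtain ⟨s1, s2, s3, s4, s5, s6, s7, s8, s9, s10, s11, s12⟩ := hs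
  rw [div_mul_eq_mul_div, div_le_iff₀ (by positivity)] at s2 s3 s4 s5 s6 s7 s8 s10 s12
  have hc₁2 : 0 < c₁ ^ 2 := by positivity
  have hΛ2 : 0 < Λ ^ 2 := by positivity
  have hε' : ∀ x : ℝ, 0 ≤ x → ε * x ≤ x := fun x hx => mul_le_of_le_one_left hx hε1.le
  have t2 : q ≤ δ / 2 := by linarith [hε' δ hδ.le]
  have t3 : q ≤ Λ ^ 2 := by linarith [hε' _ hΛ2.le]
  have t4 : A * q ≤ c₁ / 4 := by linarith [hε' _ hc₁.le]
  have t5 : C₁ * q ≤ c₁ ^ 2 / 2 := by linarith [hε' _ hc₁2.le]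
  have t6 : q ≤ C₂ := by linarith [hε' _ hC₂.le]
  have t7 : q ≤ C₃ := by linarith [hε' _ hC₃.le]
  obtain ⟨ζ, hζ⟩ : ∃ ζ, ζ = β * q := ⟨_, rfl⟩
  have hζ0 : 0 ≤ ζ := by rw [hζ]; positivity
  have t8 : ζ * (R + 3) ≤ G / 2 := by rw [hζ]; linarith [hε' _ hG0.le]
  have t9 : ζ * (R + 3) ≤ 1 / 6 := by rw [hζ]; linarith
  have t10 : 100 * ζ ≤ ε * g := by rw [hζ]; linarith
  have t11 : 100 * ζ ≤ ε := by rw [hζ]; linarith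
  -- the size `r = √n τ` of the off-diagonal part of a column
  obtain ⟨r, hr⟩ : ∃ r, r = √(n : ℝ) * τ := ⟨_, rfl⟩
  have hr0 : 0 ≤ r := by rw [hr]; positivity
  have hrq : r ≤ q := by
    rw [hr, hqdef]
    exact mul_le_mul_of_nonneg_right (KernelSGD.sqrt_natCast_le n) hτ
  have hr2 : r ^ 2 = n * τ ^ 2 := by rw [hr, mul_pow, Real.sq_sqrt (Nat.cast_nonneg n)]
  have hr2q : r ^ 2 ≤ q := by
    have := mul_le_mul (show r ≤ 1 by linarith) hrq hr0 zero_le_one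
    linarith
  rw [mul_assoc, ← hr] at hη₁l hη₁u hη₂u
  obtain ⟨hη₁0, hη₁2, hη₁L, hη₁c⟩ := KernelSGD.stage_one_step_size hc₁ (hd 0) (hd 1) hC₁ hC₂ hr0
    ((mul_le_mul_of_nonneg_left hrq hC₁.le).trans t5) (by linarith) hη₁l hη₁u
  obtain ⟨hη₂L, hη₂c⟩ := KernelSGD.stage_two_step_size hc₁ (hd 0) hC₃ hr0 (by linarith) hη₂0 hη₂u
  have hl₁0 : 0 ≤ K 0 0 := hc₁.le.trans (hd 0)
  have hl₁Λ : K 0 0 ≤ Λ := (hd₂ 0).trans hc₂Λ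
  have hl₁sq : K 0 0 ^ 2 ≤ Λ ^ 2 := pow_le_pow_left₀ hl₁0 hl₁Λ 2
  have hg1 : g ≤ 1 := by
    have hδΛ : δ ≤ Λ ^ 2 := by linarith [sq_nonneg (K 1 1)]
    have hG1 : G ≤ 1 := by
      rw [hG, div_le_one hΛ2]
      have : c₁ ^ 2 / (4 * Λ ^ 2) ≤ 1 := by
        rw [div_le_one (by positivity)]
        linarith [pow_le_pow_left₀ hc₁.le hcΛ 2]
      linarith [mul_le_mul this hδΛ hδ.le zero_le_one]
    rw [hg, div_le_one (by positivity)]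
    linarith
  obtain ⟨u, a, hu1, ha, hu, hω, ha1, ha2, hσ⟩ := KernelSGD.exists_dual_frame hH hc₁ hτ hoff hd
    hl₁Λ (by rw [← hA, ← hqdef]; exact t4)
  rw [← hA, ← hqdef] at hω
  obtain ⟨w, hw⟩ : ∃ w, w = ‖KernelSGD.perp u (KernelSGD.col K 0)‖ := ⟨_, rfl⟩
  have hw0 : 0 ≤ w := by rw [hw]; positivity
  have hcol0 := KernelSGD.norm_col_sq_le hoff 0
  rw [← hr2] at hcol0
  have haL : a ^ 2 ≤ 2 * Λ ^ 2 := by linarith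
  have hdet : IsUnit K.det := by
    have hq4 : n * τ ≤ c₁ / 4 := by
      rw [← hqdef]
      have : 1 ≤ A := by rw [hA]; linarith [show 0 ≤ 2 * Λ / c₁ by positivity]
      linarith [le_mul_of_one_le_left hq0 this]
    exact KernelSGD.isUnit_det_of_le_norm_app (c := c₁ - n * τ) (by linarith)
      (KernelSGD.le_norm_app hτ hoff hd)
  have hkL : ∀ j, j ≠ 0 → ‖KernelSGD.col K j‖ ^ 2 ≤ K 1 1 ^ 2 + r ^ 2 := by
    intro j hj
    have h1 : K j j ≤ K 1 1 := by
      refine hanti ?_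
      rw [Fin.le_def, Fin.val_one', Nat.mod_eq_of_lt hn]
      exact Nat.one_le_iff_ne_zero.2 fun h => hj (Fin.ext (by simpa using h))
    have h2 : K j j ^ 2 ≤ K 1 1 ^ 2 := pow_le_pow_left₀ (hc₁.le.trans (hd j)) h1 2
    have := KernelSGD.norm_col_sq_le hoff j
    rw [← hr2] at this
    linarith
  rw [← hw] at hω ha1
  obtain ⟨hκ₁, he₁⟩ := KernelSGD.coupling_le hc₁ hcΛ hη₁c hw0 hω t4 ha.le haL
  obtain ⟨hκ₂, he₂⟩ := KernelSGD.coupling_le hc₁ hcΛ hη₂c hw0 hω t4 ha.le haL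
  rw [← hβ, ← hζ] at hκ₁ he₁ hκ₂ he₂
  have hgap₁ := KernelSGD.stage_one_gap hc₁ hcΛ hl₁0 hl₁Λ hδ.le hgap hη₁0 hη₁2 hη₁L
    (by linarith) ha1
  rw [← hG] at hgap₁
  obtain ⟨m₁, hm₁⟩ : ∃ m₁, m₁ = η₁ * (2 - η₁ * (K 1 1 ^ 2 + r ^ 2)) / 2 * (c₁ ^ 2 / 4) := ⟨_, rfl⟩
  have hm₁n : m₁ ≤ n := by
    have h0 : 0 ≤ η₁ * (K 1 1 ^ 2 + r ^ 2) := by positivity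
    have h1 : η₁ * c₁ ^ 2 ≤ 2 := by rwa [le_div_iff₀ hc₁2] at hη₁c
    have h2 : 0 ≤ η₁ * c₁ ^ 2 := by positivity
    have h3 := mul_le_mul h1 (show 2 - η₁ * (K 1 1 ^ 2 + r ^ 2) ≤ 2 by linarith) (by linarith)
      zero_le_two
    rw [hm₁]
    linarith
  have hν₁ : -ζ ≤ η₁ * a ^ 2 - 2 := by linarith [mul_le_mul_of_nonneg_left ha1 hη₁0]
  have hν₁V : η₁ * a ^ 2 - 2 ≤ V := by
    have : η₁ * a ^ 2 ≤ 2 / c₁ ^ 2 * (2 * Λ ^ 2) := by gcongr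
    have e : V = 2 / c₁ ^ 2 * (2 * Λ ^ 2) := by rw [hV]; ring
    linarith
  have hη₂L' : η₂ * (K 1 1 ^ 2 + r ^ 2) ≤ 2 := by
    linarith [mul_le_mul_of_nonneg_left hgap hη₂0.le, mul_nonneg hη₂0.le hδ.le]
  have hgV : g * (1 + V) = G / 2 := by rw [hg]; field_simp
  -- With `q = nτ`: γ₁ ≤ λ₁ + q and `a ≥ λ₁ - A q`, while `(1 + A) q ≤ ε c₁ / 4 ≤ ε γ₁ / 4`.
  have haγ : (1 - ε / 4) * (⨆ j, hK.isHermitian.eigenvalues j) ≤ a := by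
    have h1 := KernelSGD.iSup_eigenvalues_le hK hτ hoff (l := K 0 0)
      fun j => hanti (Fin.zero_le j)
    rw [← hqdef] at h1
    have h2 := KernelSGD.le_iSup_eigenvalues hK 0
    have h3 : K 0 0 - w ≤ a := by
      refine le_of_sq_le_sq (le_trans ?_ ha1) ha.le
      have : w ≤ K 0 0 := by linarith [hd 0]
      linarith [mul_nonneg hw0 (sub_nonneg.2 this)]
    linarith [mul_le_mul_of_nonneg_left ((hd 0).trans h2) hε.le]
  set k₁ := ⌊(T + 1) / g * n * Real.log (1 / ε)⌋₊ with hk₁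
  refine ⟨k₁, k₁ + 1, Nat.lt_succ_self _, Nat.floor_le ?_, ?_⟩
  · have : 0 ≤ Real.log (1 / ε) := Real.log_nonneg (by rw [le_div_iff₀ hε]; linarith)
    positivity
  intro Ω _ μ _ i hi
  have hstep := KernelSGD.err_succ hH hdet y α₀ η₁ η₂ k₁
  have hB : KernelSGD.DependsOnPast (KernelSGD.err K y α₀ η₁ η₂ k₁) :=
    KernelSGD.dependsOnPast_of_succ
      (Φ := fun t j v => KernelSGD.relax (KernelSGD.twoStage η₁ η₂ k₁ t) (KernelSGD.col K j) v)
      (KernelSGD.err_zero K y α₀ η₁ η₂ k₁) (fun x t => hstep x t)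
  set S : ℕ → ℝ := fun t =>
    ∫ ω, |(inner ℝ u (KernelSGD.err K y α₀ η₁ η₂ k₁ (fun s => i s ω) t) : ℝ)| ∂μ with hS
  set Z : ℕ → ℝ := fun t =>
    ∫ ω, ‖KernelSGD.perp u (KernelSGD.err K y α₀ η₁ η₂ k₁ (fun s => i s ω) t)‖ ∂μ with hZ
  have hSnn : ∀ t, 0 ≤ S t := fun t => integral_nonneg fun ω => abs_nonneg _
  have hS0 : β₀ ≤ S 0 := by
    have e : S 0 = |(inner ℝ u (α₀ - KernelSGD.alphaHat K y) : ℝ)| := by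
      simp [hS, KernelSGD.err_zero]
    rw [e]
    exact hβ₀P.trans (KernelSGD.norm_projOne_le hH hdet hu1 ha hu _)
  have hZ0 : Z 0 ≤ R * S 0 := by
    have e : Z 0 = ‖KernelSGD.perp u (α₀ - KernelSGD.alphaHat K y)‖ := by
      simp [hZ, KernelSGD.err_zero]
    rw [e]
    refine (KernelSGD.norm_perp_le hu1 _).trans (hM.trans ((le_abs_self M).trans ?_))
    calc |M| = R * β₀ := by rw [hR]; field_simp
      _ ≤ R * S 0 := by gcongr
  have hstage₁ : ∀ t < k₁, n * Z (t + 1) ≤ (n - m₁ + ζ) * Z t + ζ * S t ∧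
      (n + (η₁ * a ^ 2 - 2)) * S t - ζ * Z t ≤ n * S (t + 1) := fun t ht =>
    KernelSGD.expected_step_of_coupling_le hi hB
      (fun x => by rw [hstep, KernelSGD.twoStage, if_pos ht]) hH hu1 ha.le hu hη₁0 hkL hη₁L hσ
      (hw ▸ hκ₁) (hw ▸ he₁) hm₁.le (by linarith [neg_abs_le (1 - η₁ * a ^ 2)])
  -- Crude rates suffice for the single η₂ step: no contraction of Z, and only `|1 - η₂ a²| ≥ 0` for
  -- S.
  have hstage₂ : n * Z (k₁ + 1) ≤ (n - 0 + ζ) * Z k₁ + ζ * S k₁ ∧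
      (n + -1) * S k₁ - ζ * Z k₁ ≤ n * S (k₁ + 1) :=
    KernelSGD.expected_step_of_coupling_le hi hB
      (fun x => by rw [hstep, KernelSGD.twoStage, if_neg (lt_irrefl _)]) hH hu1 ha.le hu hη₂0.le
      hkL hη₂L' hσ (hw ▸ hκ₂) (hw ▸ he₂)
      (mul_nonneg (div_nonneg (mul_nonneg hη₂0.le (sub_nonneg.2 hη₂L')) zero_le_two)
        (by positivity))
      (by linarith [abs_nonneg (1 - η₂ * a ^ 2)])
  have hrec := KernelSGD.ratio_two_stage (S := S) (Z := Z) (n := n) (μ := m₁)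
    (ν := η₁ * a ^ 2 - 2) (V := V) (ζ := ζ) (g := g) (R := R) (k := k₁) hn2 (hβ₀.trans_le hS0) hR0
    hZ0 hg0 hg1 hζ0 hm₁n hν₁V hV0.le hν₁ (by linarith [hε' _ hg0.le]) t9 (by linarith)
    (fun t ht => (hstage₁ t ht).1) (fun t ht => (hstage₁ t ht).2)
    (by simpa only [sub_zero] using hstage₂.1) hstage₂.2
  refine KernelSGD.quotient_bounds hK hu1 ha.le hu
    (fun f => hi.integrable_comp hB (k₁ + 1) f) hε haγ hrec.1 fun hε2 => ?_
  refine hrec.2.trans (mul_le_mul_of_nonneg_right ?_ (hSnn _))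
  have h1 := KernelSGD.one_sub_div_pow_floor_mul_le (n := n) hg0 hg1 (by linarith) hR0 hT.le hε
    hε2.le
  have h2 : 2 * ζ / g ≤ 2 * ε / 100 := by
    rw [div_le_iff₀ hg0]; linarith
  -- The budget is `6 (ε/100 + 2ε/100) + 3ε/100 = 21ε/100 ≤ ε/4`.
  linarith
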